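/- Let $\mathcal R_1\subset\mathcal R_2$ be von Neumann algebras acting on a complex Hilbert space $\mathcal H$, let $\Omega\in\mathcal H$, and let $u,v\in\mathcal R_2$ and $u',v'\in\mathcal R_1'$ be unitaries. Conventions. A vector is standard for a von Neumann algebra $\mathcal R$ if it is cyclic and separating for $\mathcal R$. For standard vectors $\Phi,\tilde\Phi$ of $\mathcal R$, $S_{\tilde\Phi,\Phi}$ is the closure of the antilinear operator $a\Phi\mapsto a^*\tilde\Phi$, $a\in\mathcal R$; $\Delta_{\tilde\Phi,\Phi}=S_{\tilde\Phi,\Phi}^*S_{\tilde\Phi,\Phi}$ is the relative modular operator, $K_{\tilde\Phi,\Phi}=-\log\Delta_{\tilde\Phi,\Phi}$ the relative modular Hamiltonian, $K_\Phi=K_{\Phi,\Phi}$, and $H(\Phi,\tilde\Phi)=\langle\Phi,K_{\tilde\Phi,\Phi}\Phi\rangle$ the relative entropy. A superscript $(i)$ means that $\mathcal R=\mathcal R_i$. For a self-adjoint operator $T$ with positive and negative parts $T_\pm$, the number $\langle\psi,T\psi\rangle=\langle\psi,T_+\psi\rangle-\langle\psi,T_-\psi\rangle\in[-\infty,\infty]$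 is well defined if $\langle\psi,T_+\psi\rangle$ and $\langle\psi,T_-\psi\rangle$ (values in $[0,\infty]$) are not both infinite. $A\le B$ means that for every $\psi$: if $\langle\psi,A_-\psi\rangle<\infty$ then $\langle\psi,B_-\psi\rangle<\infty$; if $\langle\psi,B_+\psi\rangle<\infty$ then $\langle\psi,A_+\psi\rangle<\infty$; and $\langle\psi,A\psi\rangle\le\langle\psi,B\psi\rangle$ whenever both sides are well defined in $[-\infty,\infty]$. (i) If $u\Omega$ and $v\Omega$ are standard for both $\mathcal R_1$ and $\mathcal R_2$, then $$K^{(1)}_{u'u\Omega,\,v'v\Omega}\le v'u\,K^{(2)}_\Omega\,u^*v'^*,\qquad H^{(1)}(v'v\Omega,u'u\Omega)\le\langle u^*v\Omega,\,K^{(2)}_\Omega u^*v\Omega\rangle,$$ where both sides of the second inequality are well defined in $[-\infty,\infty]$. (ii) If $u'\Omega$ and $v'\Omega$ are standard for both $\mathcal R_1$ and $\mathcal R_2$, then $$K^{(2)}_{uu'\Omega,\,vv'\Omega}\ge uv'\,K^{(1)}_\Omega\,v'^*u^*,\qquad H^{(2)}(vv'\Omega,uu'\Omega)\ge\langle v'^*u^*vv'\Omega,\,K^{(1)}_\Omega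 v'^*u^*vv'\Omega\rangle,$$ where $H^{(2)}(vv'\Omega,uu'\Omega)$ is well defined in $[-\infty,\infty]$, and the right-hand side of the second inequality is well defined whenever $H^{(2)}(vv'\Omega,uu'\Omega)<\infty$ (if it is not well defined, the left-hand side is $+\infty$ and the inequality is read as true). -/

import Mathlib

open MeasureTheory
open scoped ENNReal ComplexConjugate InnerProductSpace

noncomputable section

namespace RelMod

variable {H : Type*} [NormedAddCommGroup H] [InnerProductSpace ℂ H] [CompleteSpace H]

/-! ### Spectral calculus of an unbounded operator -/

/-- `μ` is the spectral measure of the (self-adjoint) operator `T` in the vector `ψ`: the finite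
Borel measure on the real line with `⟨ψ, (T - z)⁻¹ ψ⟩ = ∫ (x - z)⁻¹ dμ(x)` for all non-real `z`.
A finite measure is determined by these integrals, and for `T` self-adjoint with projection-valued
spectral measure `E` it is `B ↦ ⟨ψ, E(B) ψ⟩`. -/
structure IsSpectralMeasureAt (T : H →ₗ.[ℂ] H) (ψ : H) (μ : Measure ℝ) : Prop where
  finite : IsFiniteMeasure μ
  resolvent : ∀ z : ℂ, z.im ≠ 0 →
    ∃ φ : T.domain, T φ - z • (φ : H) = ψ ∧ ⟪ψ, (φ : H)⟫_ℂ = ∫ x : ℝ, ((x : ℂ) - z)⁻¹ ∂μ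

open Classical in
/-- The spectral measure of `T` in the vector `ψ`. -/
def spectralMeasureAt (T : H →ₗ.[ℂ] H) (ψ : H) : Measure ℝ :=
  if h : ∃ μ, IsSpectralMeasureAt T ψ μ then h.choose else 0

/-- The self-adjoint operator `K` is `f(T)` in the sense of the Borel functional calculus: the
spectral measures of `K` are the images under `f` of those of `T`. -/
structure IsFunctionOf (f : ℝ → ℝ) (T K : H →ₗ.[ℂ] H) : Prop where
  selfAdjoint : IsSelfAdjoint K
  spectral : ∀ ψ : H, IsSpectralMeasureAt K ψ ((spectralMeasureAt T ψ).map f)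

open Classical in
/-- The operator `f(T)`. -/
def functionOf (f : ℝ → ℝ) (T : H →ₗ.[ℂ] H) : H →ₗ.[ℂ] H :=
  if h : ∃ K, IsFunctionOf f T K then h.choose else ⊥

/-- `⟨ψ, T₊ ψ⟩ ∈ [0, ∞]` for the positive part `T₊` of the self-adjoint operator `T`. -/
def posForm (T : H →ₗ.[ℂ] H) (ψ : H) : ℝ≥0∞ :=
  ∫⁻ x, ENNReal.ofReal x ∂(spectralMeasureAt T ψ)

/-- `⟨ψ, T₋ ψ⟩ ∈ [0, ∞]` for the negative part `T₋` of the self-adjoint operator `T`. -/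
def negForm (T : H →ₗ.[ℂ] H) (ψ : H) : ℝ≥0∞ :=
  ∫⁻ x, ENNReal.ofReal (-x) ∂(spectralMeasureAt T ψ)

/-- The quadratic form `⟨ψ, T ψ⟩` is well defined in `[-∞, ∞]`. -/
def HasForm (T : H →ₗ.[ℂ] H) (ψ : H) : Prop :=
  posForm T ψ ≠ ⊤ ∨ negForm T ψ ≠ ⊤

/-- The quadratic form `⟨ψ, T ψ⟩ = ⟨ψ, T₊ ψ⟩ - ⟨ψ, T₋ ψ⟩` of a self-adjoint operator, in
`[-∞, ∞]`, to be used when `HasForm T ψ` (otherwise the value is `⊤ - ⊤ = ⊥`). -/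
def form (T : H →ₗ.[ℂ] H) (ψ : H) : EReal :=
  (posForm T ψ : EReal) - (negForm T ψ : EReal)

/-- `A ≤ B` for self-adjoint operators, not necessarily semibounded, in the sense of quadratic
forms: if the form of `A` is `> -∞` then so is that of `B`, if the form of `B` is `< ∞` then so is
that of `A`, and `⟨ψ, A ψ⟩ ≤ ⟨ψ, B ψ⟩` for all `ψ` where both are well defined in `[-∞, ∞]`, in
particular on the intersection of the form domains. -/
def FormLE (A B : H →ₗ.[ℂ] H) : Prop :=
  ∀ ψ : H, (negForm A ψ ≠ ⊤ → negForm B ψ ≠ ⊤) ∧ (posForm B ψ ≠ ⊤ → posForm A ψ ≠ ⊤) ∧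
    (HasForm A ψ → HasForm B ψ → form A ψ ≤ form B ψ)

/-- The operator `w T w*` on the domain `{ψ | w* ψ ∈ D(T)}`, for `w` unitary. -/
def conjBy (w : H →L[ℂ] H) (T : H →ₗ.[ℂ] H) : H →ₗ.[ℂ] H where
  domain := T.domain.comap ((star w : H →L[ℂ] H) : H →ₗ[ℂ] H)
  toFun :=
    { toFun := fun ψ => w (T ⟨(star w : H →L[ℂ] H) ψ, ψ.2⟩)
      map_add' := by
        intro x y
        rw [← map_add, ← LinearPMap.map_add]
        congr 2
        exact Subtype.ext (map_add (star w : H →L[ℂ] H) (x : H) (y : H))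
      map_smul' := by
        intro c x
        rw [RingHom.id_apply, ← map_smul, ← LinearPMap.map_smul]
        congr 2
        exact Subtype.ext (map_smul (star w : H →L[ℂ] H) c (x : H)) }

/-! ### Relative modular theory -/

/-- `Ω` is standard for `R`: the map `a ↦ a Ω` on `R` is injective and has dense range. -/
structure IsStandard (R : VonNeumannAlgebra H) (Ω : H) : Prop where
  separating : Set.InjOn (fun a : H →L[ℂ] H => a Ω) (R : Set (H →L[ℂ] H))
  cyclic : Dense ((fun a : H →L[ℂ] H => a Ω) '' (R : Set (H →L[ℂ] H)))

/-- The closure of the graph `{(a Ω, a* Ω') | a ∈ R}`. -/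
def tomitaGraph (R : VonNeumannAlgebra H) (Ω' Ω : H) : Set (H × H) :=
  closure {p | ∃ a ∈ R, p = (a Ω, (star a : H →L[ℂ] H) Ω')}

lemma tomitaGraph_zero (R : VonNeumannAlgebra H) (Ω' Ω : H) :
    (0 : H × H) ∈ tomitaGraph R Ω' Ω :=
  subset_closure ⟨0, zero_mem R, by simp [Prod.ext_iff]⟩

lemma tomitaGraph_add {R : VonNeumannAlgebra H} {Ω' Ω : H} {p q : H × H}
    (hp : p ∈ tomitaGraph R Ω' Ω) (hq : q ∈ tomitaGraph R Ω' Ω) :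
    p + q ∈ tomitaGraph R Ω' Ω := by
  refine map_mem_closure₂ continuous_add hp hq ?_
  rintro _ ⟨a, ha, rfl⟩ _ ⟨b, hb, rfl⟩
  exact ⟨a + b, add_mem ha hb, by simp⟩

lemma tomitaGraph_smul {R : VonNeumannAlgebra H} {Ω' Ω : H} (c : ℂ) {p : H × H}
    (hp : p ∈ tomitaGraph R Ω' Ω) : (c • p.1, conj c • p.2) ∈ tomitaGraph R Ω' Ω := by
  refine map_mem_closure (f := fun p : H × H => (c • p.1, conj c • p.2)) (by fun_prop) hp ?_
  rintro _ ⟨a, ha, rfl⟩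
  exact ⟨c • a, R.toStarSubalgebra.smul_mem ha c, by simp⟩

open Classical in
/-- The relative Tomita operator `S_{Ω', Ω}`: the closure of the antilinear operator
`a Ω ↦ a* Ω'`, `a ∈ R`. (The value is zero if the closure of the graph is not a graph, which does
not happen for standard vectors.) -/
def relTomita (R : VonNeumannAlgebra H) (Ω' Ω : H) : H →ₛₗ.[starRingEnd ℂ] H where
  domain :=
    { carrier := {ψ | ∃ η, (ψ, η) ∈ tomitaGraph R Ω' Ω}
      zero_mem' := ⟨0, tomitaGraph_zero R Ω' Ω⟩
      add_mem' := fun ⟨η, hη⟩ ⟨ξ, hξ⟩ => ⟨η + ξ, tomitaGraph_add hη hξ⟩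
      smul_mem' := fun c _ ⟨η, hη⟩ => ⟨conj c • η, tomitaGraph_smul c hη⟩ }
  toFun :=
    if h : ∀ ψ η ξ : H, (ψ, η) ∈ tomitaGraph R Ω' Ω → (ψ, ξ) ∈ tomitaGraph R Ω' Ω → η = ξ then
      { toFun := fun ψ => ψ.2.choose
        map_add' := fun x y =>
          h _ _ _ (x + y).2.choose_spec (tomitaGraph_add x.2.choose_spec y.2.choose_spec)
        map_smul' := fun c x =>
          h _ _ _ (c • x).2.choose_spec (tomitaGraph_smul c x.2.choose_spec) }
    else 0

/-- The graph of `S* S` for an antilinear operator `S`, where `S*` is the antilinear adjoint,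
`⟨S* η, χ⟩ = ⟨S χ, η⟩`. -/
def adjointMulGraph (S : H →ₛₗ.[starRingEnd ℂ] H) : Submodule ℂ (H × H) where
  carrier := {p | ∃ ψ : S.domain, (ψ : H) = p.1 ∧ ∀ χ : S.domain, ⟪p.2, (χ : H)⟫_ℂ = ⟪S χ, S ψ⟫_ℂ}
  zero_mem' := ⟨0, rfl, fun χ => by simp⟩
  add_mem' := by
    rintro p q ⟨x, hx, hx'⟩ ⟨y, hy, hy'⟩
    refine ⟨x + y, by simp [hx, hy], fun χ => ?_⟩
    rw [LinearPMap.map_add, inner_add_right, ← hx', ← hy', Prod.snd_add, inner_add_left]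
  smul_mem' := by
    rintro c p ⟨x, hx, hx'⟩
    refine ⟨c • x, by simp [hx], fun χ => ?_⟩
    have h : S (c • x) = conj c • S x := S.toFun.map_smulₛₗ c x
    rw [h, inner_smul_right, ← hx', Prod.smul_snd, inner_smul_left]

/-- The relative modular operator `Δ_{Ω', Ω} = S* S` with `S = S_{Ω', Ω}`, that is, the square of
the positive factor in the polar decomposition `S = J Δ^{1/2}`. -/
def relModularOperator (R : VonNeumannAlgebra H) (Ω' Ω : H) : H →ₗ.[ℂ] H :=
  (adjointMulGraph (relTomita R Ω' Ω)).toLinearPMap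

/-- The relative modular Hamiltonian `K_{Ω', Ω} = -log Δ_{Ω', Ω}`. -/
def relModularHamiltonian (R : VonNeumannAlgebra H) (Ω' Ω : H) : H →ₗ.[ℂ] H :=
  functionOf (fun x => -Real.log x) (relModularOperator R Ω' Ω)

/-- The modular Hamiltonian `K_Ω = K_{Ω, Ω}`. -/
def modularHamiltonian (R : VonNeumannAlgebra H) (Ω : H) : H →ₗ.[ℂ] H :=
  relModularHamiltonian R Ω Ω

/-- The relative entropy `H(Ω, Ω') = ⟨Ω, K_{Ω', Ω} Ω⟩`. -/
def relativeEntropy (R : VonNeumannAlgebra H) (Ω Ω' : H) : EReal :=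
  form (relModularHamiltonian R Ω' Ω) Ω

end RelMod

end

/-! Up to unitaries, one Tomita operator extends the other. In (i) take `a ∈ R₁` and `b = u* a v ∈
R₂`. Since `u'` and `v'` commute with `R₁`, `V = (v'u)*` sends `a v'vΩ` to `bΩ` and `W = v*u'*`
sends `a* u'uΩ` to `b*Ω`. Hence `V × W` maps the graph of `S⁽¹⁾` into that of `S⁽²⁾`. A larger graph
means a larger form domain with the same values of `‖S·‖²`, hence a smaller `S*S` and a larger `-log
S*S`. Part (ii) is the same with `b = u a v*`, `V = uv'`, `W = vu'` (`relModularHamiltonian_mono`).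

Monotonicity of `-log` (`negLog_mono`) is reduced to resolvents: `⟨ψ, (S*S + t)⁻¹ψ⟩` is the maximum
over `χ ∈ D(S)` of `2 Re⟨ψ, χ⟩ - ‖Sχ‖² - t‖χ‖²`, so it grows with the graph. As `-log` is unbounded
on both sides, it is split as `log (1 + x⁻¹) - log (1 + x)`. Both terms are nonnegative integrals of
resolvents, and they differ from the positive and negative parts of `-log x` by the same bounded
function.

The entropies are well defined because `RΦ ⊆ D(S)` and `log (1 + x) ≤ x`: on `D(S)` the negative
part of `-log S*S` has finite form (`negForm_ne_top`).

Spectral measures and `-log` are defined by choice, so existence and uniqueness have to be supplied.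
Uniqueness is Stieltjes inversion. Existence uses the bounded operator `B = (1 + S*S)⁻¹`, obtained
by projecting onto the graph of `S`: its spectral measures are pushed forward along `b ↦ (1 - b)/b`,
and `-log S*S` is built from its resolvents, which are continuous functions of `B`. -/

namespace RelMod

set_option linter.unusedSectionVars false

variable {H : Type*} [NormedAddCommGroup H] [InnerProductSpace ℂ H] [CompleteSpace H]

/-! ### Finite measures on the line are determined by their Stieltjes transforms. -/

section Stieltjes

open scoped BoundedContinuousFunction
open Filter Topology

lemma ofReal_sub_ne_zero {z : ℂ} (hz : z.im ≠ 0) (x : ℝ) : (x : ℂ) - z ≠ 0 := by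
  intro h
  apply hz
  have := congrArg Complex.im h
  simpa using this

lemma abs_im_le_norm_ofReal_sub (z : ℂ) (x : ℝ) : |z.im| ≤ ‖(x : ℂ) - z‖ := by
  have := Complex.abs_im_le_norm ((x : ℂ) - z)
  simpa using this

lemma norm_inv_ofReal_sub_le {z : ℂ} (hz : z.im ≠ 0) (x : ℝ) :
    ‖((x : ℂ) - z)⁻¹‖ ≤ |z.im|⁻¹ := by
  rw [norm_inv]
  exact inv_anti₀ (abs_pos.mpr hz) (abs_im_le_norm_ofReal_sub z x)

/-- The bounded continuous function `x ↦ (x - z)⁻¹` on the real line. -/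
noncomputable def resolventFun (z : ℂ) (hz : z.im ≠ 0) : ℝ →ᵇ ℂ :=
  BoundedContinuousFunction.ofNormedAddCommGroup (fun x : ℝ => ((x : ℂ) - z)⁻¹)
    (Continuous.inv₀ (by fun_prop) (ofReal_sub_ne_zero hz)) |z.im|⁻¹
    (norm_inv_ofReal_sub_le hz)

@[simp] lemma resolventFun_apply (z : ℂ) (hz : z.im ≠ 0) (x : ℝ) :
    resolventFun z hz x = ((x : ℂ) - z)⁻¹ := rfl

lemma resolventFun_sub (z w : ℂ) (hz : z.im ≠ 0) (hw : w.im ≠ 0) :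
    resolventFun z hz - resolventFun w hw = (z - w) • (resolventFun z hz * resolventFun w hw) := by
  ext x
  have h1 := ofReal_sub_ne_zero hz x
  have h2 := ofReal_sub_ne_zero hw x
  simp only [BoundedContinuousFunction.coe_sub, Pi.sub_apply, resolventFun_apply,
    BoundedContinuousFunction.coe_smul, BoundedContinuousFunction.coe_mul, Pi.mul_apply,
    smul_eq_mul]
  field_simp
  ring

lemma norm_resolventFun_le (z : ℂ) (hz : z.im ≠ 0) : ‖resolventFun z hz‖ ≤ |z.im|⁻¹ :=
  BoundedContinuousFunction.norm_ofNormedAddCommGroup_le _ (by positivity) _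

/-- The linear span of the constants and the resolvent functions. -/
noncomputable def resolventSpan : Submodule ℂ (ℝ →ᵇ ℂ) :=
  Submodule.span ℂ (insert 1 {f | ∃ z hz, f = resolventFun z hz})

lemma resolventFun_mem (z : ℂ) (hz : z.im ≠ 0) : resolventFun z hz ∈ resolventSpan :=
  Submodule.subset_span (Or.inr ⟨z, hz, rfl⟩)

lemma one_mem_resolventSpan : (1 : ℝ →ᵇ ℂ) ∈ resolventSpan :=
  Submodule.subset_span (Or.inl rfl)

lemma resolventFun_mul_mem_of_ne {z w : ℂ} (hz : z.im ≠ 0) (hw : w.im ≠ 0) (hzw : z ≠ w) :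
    resolventFun z hz * resolventFun w hw ∈ resolventSpan := by
  have h := resolventFun_sub z w hz hw
  have h' : resolventFun z hz * resolventFun w hw
      = (z - w)⁻¹ • (resolventFun z hz - resolventFun w hw) := by
    rw [h, smul_smul, inv_mul_cancel₀ (sub_ne_zero.mpr hzw), one_smul]
  rw [h']
  exact resolventSpan.smul_mem _
    (resolventSpan.sub_mem (resolventFun_mem z hz) (resolventFun_mem w hw))

/-- The resolvent identity linearizes products only at distinct points. The square is a uniform
limit of such products, with second point `z + 1/(n+1)`; the shift is real, so the bound `|z.im|⁻¹`
is unchanged. -/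
lemma resolventFun_mul_self_mem (z : ℂ) (hz : z.im ≠ 0) :
    resolventFun z hz * resolventFun z hz ∈ resolventSpan.topologicalClosure := by
  have him (n : ℕ) : (z + ((1 / ((n : ℝ) + 1) : ℝ) : ℂ)).im = z.im := by
    simp only [Complex.add_im, Complex.ofReal_im, add_zero]
  have hw (n : ℕ) : (z + ((1 / ((n : ℝ) + 1) : ℝ) : ℂ)).im ≠ 0 := by rw [him]; exact hz
  have hlim : Tendsto (fun n : ℕ => resolventFun _ (hw n)) atTop (𝓝 (resolventFun z hz)) := by
    rw [tendsto_iff_norm_sub_tendsto_zero]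
    have h0 : Tendsto (fun n : ℕ => (1 / ((n : ℝ) + 1)) * (|z.im|⁻¹ * |z.im|⁻¹)) atTop (𝓝 0) := by
      simpa using (tendsto_one_div_add_atTop_nhds_zero_nat (𝕜 := ℝ)).mul_const
        (|z.im|⁻¹ * |z.im|⁻¹)
    refine squeeze_zero (fun n => norm_nonneg _) (fun n => ?_) h0
    rw [resolventFun_sub, norm_smul]
    have h1 : ‖z + ((1 / ((n : ℝ) + 1) : ℝ) : ℂ) - z‖ = 1 / ((n : ℝ) + 1) := by
      rw [add_sub_cancel_left, Complex.norm_real, Real.norm_of_nonneg (by positivity)]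
    rw [h1]
    refine mul_le_mul_of_nonneg_left ((norm_mul_le _ _).trans ?_) (by positivity)
    have h2 := norm_resolventFun_le _ (hw n)
    rw [him] at h2
    exact mul_le_mul h2 (norm_resolventFun_le z hz) (norm_nonneg _) (by positivity)
  refine mem_closure_of_tendsto ((tendsto_const_nhds (x := resolventFun z hz)).mul hlim)
    (Eventually.of_forall fun n => resolventFun_mul_mem_of_ne hz (hw n) ?_)
  intro h
  have h1 : ((1 / ((n : ℝ) + 1) : ℝ) : ℂ) = 0 := by simpa using h.symm
  have h2 : (1 / ((n : ℝ) + 1) : ℝ) = 0 := by exact_mod_cast h1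
  have h3 : (0 : ℝ) < 1 / ((n : ℝ) + 1) := by positivity
  linarith

lemma mul_mem_resolventSpan_closure {f g : ℝ →ᵇ ℂ} (hf : f ∈ resolventSpan)
    (hg : g ∈ resolventSpan) : f * g ∈ resolventSpan.topologicalClosure := by
  have hle := resolventSpan.le_topologicalClosure
  refine Submodule.span_induction₂
    (p := fun f g _ _ => f * g ∈ resolventSpan.topologicalClosure) ?_ ?_ ?_ ?_ ?_ ?_ ?_ hf hg
  · rintro f g (rfl | ⟨z, hz, rfl⟩) (rfl | ⟨w, hw, rfl⟩)
    · rw [one_mul]; exact hle one_mem_resolventSpan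
    · rw [one_mul]; exact hle (resolventFun_mem w hw)
    · rw [mul_one]; exact hle (resolventFun_mem z hz)
    · by_cases h : z = w
      · subst h; exact resolventFun_mul_self_mem z hz
      · exact hle (resolventFun_mul_mem_of_ne hz hw h)
  · intro y _; rw [zero_mul]; exact zero_mem _
  · intro y _; rw [mul_zero]; exact zero_mem _
  · intro x y z _ _ _ h1 h2; rw [add_mul]; exact add_mem h1 h2
  · intro x y z _ _ _ h1 h2; rw [mul_add]; exact add_mem h1 h2
  · intro r x y _ _ h; rw [smul_mul_assoc]; exact Submodule.smul_mem _ r h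
  · intro r x y _ _ h; rw [mul_smul_comm]; exact Submodule.smul_mem _ r h

lemma star_mem_resolventSpan {f : ℝ →ᵇ ℂ} (hf : f ∈ resolventSpan) :
    star f ∈ resolventSpan := by
  induction hf using Submodule.span_induction with
  | mem f hf =>
    rcases hf with rfl | ⟨z, hz, rfl⟩
    · rw [star_one]; exact one_mem_resolventSpan
    · have hz' : (conj z).im ≠ 0 := by simpa using hz
      convert resolventFun_mem (conj z) hz' using 1
      ext x
      simp
  | zero => rw [star_zero]; exact zero_mem _
  | add x y _ _ h1 h2 => rw [star_add]; exact add_mem h1 h2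
  | smul r x _ h => rw [star_smul]; exact Submodule.smul_mem _ _ h

/-- The closed star algebra generated by the resolvent functions. -/
noncomputable def resolventAlgebra : StarSubalgebra ℂ (ℝ →ᵇ ℂ) where
  carrier := resolventSpan.topologicalClosure
  mul_mem' := by
    intro f g hf hg
    have := map_mem_closure₂ (u := (resolventSpan.topologicalClosure : Set (ℝ →ᵇ ℂ)))
      continuous_mul hf hg (fun a ha b hb => mul_mem_resolventSpan_closure ha hb)
    rwa [resolventSpan.isClosed_topologicalClosure.closure_eq] at this
  add_mem' := add_mem
  algebraMap_mem' := by
    intro r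
    change algebraMap ℂ (ℝ →ᵇ ℂ) r ∈ resolventSpan.topologicalClosure
    rw [Algebra.algebraMap_eq_smul_one]
    exact Submodule.smul_mem _ _ (resolventSpan.le_topologicalClosure one_mem_resolventSpan)
  star_mem' := by
    intro f hf
    exact map_mem_closure continuous_star hf (fun a ha => star_mem_resolventSpan ha)

lemma continuous_integral_boundedContinuous (μ : Measure ℝ) [IsFiniteMeasure μ] :
    Continuous (fun f : ℝ →ᵇ ℂ => ∫ x, f x ∂μ) := by
  refine (LipschitzWith.of_dist_le_mul (K := (μ.real Set.univ).toNNReal) fun f g => ?_).continuous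
  rw [dist_eq_norm, dist_eq_norm, ← integral_sub (f.integrable μ) (g.integrable μ),
    Real.coe_toNNReal _ measureReal_nonneg]
  exact BoundedContinuousFunction.norm_integral_le_mul_norm μ (f - g)

/-- Recovers the total mass from the Stieltjes transform: along `z = i(n+1)` the functions `-z (x -
z)⁻¹` are bounded by `1` and tend to `1`. -/
lemma tendsto_integral_resolvent (μ : Measure ℝ) [IsFiniteMeasure μ] :
    Tendsto (fun n : ℕ => ∫ x : ℝ, -(((n : ℝ) + 1 : ℝ) * Complex.I) *
      ((x : ℂ) - ((n : ℝ) + 1 : ℝ) * Complex.I)⁻¹ ∂μ) atTop (𝓝 (∫ _, (1 : ℂ) ∂μ)) := by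
  have him (n : ℕ) : ((((n : ℝ) + 1 : ℝ) : ℂ) * Complex.I).im = (n : ℝ) + 1 := by simp
  have him' (n : ℕ) : ((((n : ℝ) + 1 : ℝ) : ℂ) * Complex.I).im ≠ 0 := by
    rw [him]; positivity
  refine tendsto_integral_of_dominated_convergence (fun _ => 1) (fun n => ?_)
    (integrable_const _) (fun n => Eventually.of_forall fun x => ?_)
    (Eventually.of_forall fun x => ?_)
  · exact (((resolventFun _ (him' n)).continuous).const_mul _).aestronglyMeasurable
  · rw [norm_mul, norm_neg, norm_mul, Complex.norm_I, mul_one, Complex.norm_real,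
      Real.norm_of_nonneg (by positivity)]
    have h := norm_inv_ofReal_sub_le (him' n) x
    rw [him, abs_of_nonneg (by positivity)] at h
    calc ((n : ℝ) + 1) * _ ≤ ((n : ℝ) + 1) * ((n : ℝ) + 1)⁻¹ := by gcongr
      _ = 1 := mul_inv_cancel₀ (by positivity)
  · have h1 : Tendsto (fun n : ℕ => (x : ℂ) * ((1 / ((n : ℝ) + 1) : ℝ) : ℂ)) atTop (𝓝 0) := by
      have := (Complex.continuous_ofReal.tendsto 0).comp
        (tendsto_one_div_add_atTop_nhds_zero_nat (𝕜 := ℝ))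
      simpa [Function.comp_def] using this.const_mul (x : ℂ)
    have h2 : Tendsto (fun n : ℕ => -Complex.I *
        ((x : ℂ) * ((1 / ((n : ℝ) + 1) : ℝ) : ℂ) - Complex.I)⁻¹) atTop
        (𝓝 (-Complex.I * (0 - Complex.I)⁻¹)) :=
      ((h1.sub_const _).inv₀ (by simp)).const_mul _
    have h3 : -Complex.I * (0 - Complex.I)⁻¹ = 1 := by
      rw [zero_sub]; exact mul_inv_cancel₀ (by simp)
    rw [h3] at h2
    refine h2.congr fun n => ?_
    have hn : (((n : ℝ) + 1 : ℝ) : ℂ) ≠ 0 := by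
      exact_mod_cast (by positivity : ((n : ℝ) + 1) ≠ 0)
    have h4 := ofReal_sub_ne_zero (him' n) x
    have h5 : (x : ℂ) * ((1 / ((n : ℝ) + 1) : ℝ) : ℂ) - Complex.I
        = ((x : ℂ) - ((n : ℝ) + 1 : ℝ) * Complex.I) / (((n : ℝ) + 1 : ℝ) : ℂ) := by
      rw [Complex.ofReal_div, Complex.ofReal_one]
      field_simp
    rw [h5, inv_div]
    field_simp

/-- A finite Borel measure on the real line is determined by its Stieltjes transform. -/
theorem measure_ext_of_stieltjes {μ ν : Measure ℝ} [IsFiniteMeasure μ] [IsFiniteMeasure ν]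
    (h : ∀ z : ℂ, z.im ≠ 0 → ∫ x : ℝ, ((x : ℂ) - z)⁻¹ ∂μ = ∫ x : ℝ, ((x : ℂ) - z)⁻¹ ∂ν) :
    μ = ν := by
  have hone : ∫ _, (1 : ℂ) ∂μ = ∫ _, (1 : ℂ) ∂ν := by
    refine tendsto_nhds_unique (tendsto_integral_resolvent μ) ?_
    refine (tendsto_integral_resolvent ν).congr fun n => ?_
    rw [integral_const_mul, integral_const_mul, h]
    simp only [Complex.mul_im, Complex.ofReal_re, Complex.I_im, Complex.ofReal_im, Complex.I_re]
    positivity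
  -- A star subalgebra of bounded continuous functions that separates points determines a finite
  -- measure on a Polish space; density in the uniform norm is not needed.
  refine ext_of_forall_mem_subalgebra_integral_eq_of_polish (𝕜 := ℂ) (A := resolventAlgebra) ?_ ?_
  · intro x y hxy
    have hI : Complex.I.im ≠ 0 := by simp
    refine ⟨resolventFun Complex.I hI, ⟨_, ⟨resolventFun Complex.I hI,
      resolventSpan.le_topologicalClosure (resolventFun_mem _ _), rfl⟩, rfl⟩, ?_⟩
    intro he
    simp only [resolventFun_apply] at he
    exact hxy (by simpa using he)
  · intro g hg
    have hcl : IsClosed {g : ℝ →ᵇ ℂ | ∫ x, g x ∂μ = ∫ x, g x ∂ν} :=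
      isClosed_eq (continuous_integral_boundedContinuous μ)
        (continuous_integral_boundedContinuous ν)
    refine closure_minimal (s := (resolventSpan : Set (ℝ →ᵇ ℂ))) ?_ hcl hg
    intro f hf
    change ∫ x, f x ∂μ = ∫ x, f x ∂ν
    induction hf using Submodule.span_induction with
    | mem f hf =>
      rcases hf with rfl | ⟨z, hz, rfl⟩
      · simpa using hone
      · exact h z hz
    | zero => simp
    | add x y _ _ h1 h2 =>
      simp only [BoundedContinuousFunction.coe_add, Pi.add_apply]
      rw [integral_add (x.integrable μ) (y.integrable μ),
        integral_add (x.integrable ν) (y.integrable ν), h1, h2]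
    | smul r x _ h =>
      simp only [BoundedContinuousFunction.coe_smul]
      rw [integral_smul, integral_smul, h]

end Stieltjes

/-! ### Spectral measures of bounded self-adjoint operators. -/

section BoundedCalculus

open CompactlySupported

/-- The functional calculus of a self-adjoint operator for complex functions of a real variable. -/
noncomputable def realCfc (B : H →L[ℂ] H) (g : ℝ → ℂ) : H →L[ℂ] H := cfc (fun w : ℂ => g w.re) B

variable {B : H →L[ℂ] H}

lemma re_mem_spectrum (hB : IsSelfAdjoint B) {w : ℂ} (hw : w ∈ spectrum ℂ B) :
    w.re ∈ spectrum ℝ B := by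
  rw [← hB.spectrumRestricts.image]
  exact ⟨w, hw, rfl⟩

lemma continuousOn_comp_re (hB : IsSelfAdjoint B) {g : ℝ → ℂ}
    (hg : ContinuousOn g (spectrum ℝ B)) :
    ContinuousOn (fun w : ℂ => g w.re) (spectrum ℂ B) :=
  hg.comp Complex.continuous_re.continuousOn fun _ hw => re_mem_spectrum hB hw

lemma realCfc_congr (hB : IsSelfAdjoint B) {f g : ℝ → ℂ} (h : (spectrum ℝ B).EqOn f g) :
    realCfc B f = realCfc B g :=
  cfc_congr fun _ hw => h (re_mem_spectrum hB hw)

lemma realCfc_mul (hB : IsSelfAdjoint B) {f g : ℝ → ℂ} (hf : ContinuousOn f (spectrum ℝ B))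
    (hg : ContinuousOn g (spectrum ℝ B)) :
    realCfc B (fun x => f x * g x) = realCfc B f * realCfc B g :=
  cfc_mul _ _ B (continuousOn_comp_re hB hf) (continuousOn_comp_re hB hg)

lemma realCfc_add (hB : IsSelfAdjoint B) {f g : ℝ → ℂ} (hf : ContinuousOn f (spectrum ℝ B))
    (hg : ContinuousOn g (spectrum ℝ B)) :
    realCfc B (fun x => f x + g x) = realCfc B f + realCfc B g :=
  cfc_add (a := B) _ _ (continuousOn_comp_re hB hf) (continuousOn_comp_re hB hg)

lemma realCfc_const_mul (hB : IsSelfAdjoint B) (c : ℂ) {f : ℝ → ℂ}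
    (hf : ContinuousOn f (spectrum ℝ B)) :
    realCfc B (fun x => c * f x) = c • realCfc B f :=
  cfc_const_mul c _ B (continuousOn_comp_re hB hf)

lemma realCfc_add_const_mul (hB : IsSelfAdjoint B) (c : ℂ) {f g : ℝ → ℂ}
    (hf : ContinuousOn f (spectrum ℝ B)) (hg : ContinuousOn g (spectrum ℝ B)) :
    realCfc B (fun x => f x + c * g x) = realCfc B f + c • realCfc B g := by
  have hcg : ContinuousOn (fun x => c * g x) (spectrum ℝ B) := continuousOn_const.mul hg
  rw [realCfc_add hB hf hcg, realCfc_const_mul hB c hg]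

lemma realCfc_star (f : ℝ → ℂ) : realCfc B (fun x => conj (f x)) = star (realCfc B f) :=
  cfc_star _ B

lemma realCfc_one (hB : IsSelfAdjoint B) : realCfc B (fun _ => 1) = 1 :=
  cfc_const_one ℂ B hB.isStarNormal

lemma realCfc_id (hB : IsSelfAdjoint B) : realCfc B (fun x => (x : ℂ)) = B := by
  have h : (spectrum ℂ B).EqOn (fun w : ℂ => ((w.re : ℝ) : ℂ)) (fun w => w) :=
    fun w hw => (hB.mem_spectrum_eq_re hw).symm
  rw [realCfc, cfc_congr h]
  exact cfc_id' ℂ B hB.isStarNormal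

/-- The positive functional `f ↦ ⟨ψ, f(B) ψ⟩` on the continuous functions on the spectrum. -/
noncomputable def spectralFunctional (hB : IsSelfAdjoint B) (ψ : H) :
    C_c(spectrum ℝ B, ℝ) →ₚ[ℝ] ℝ :=
  PositiveLinearMap.mk₀
    { toFun := fun f => (⟪ψ, cfcHom (R := ℝ) hB f.toContinuousMap ψ⟫_ℂ).re
      map_add' := fun f g => by
        have : (f + g).toContinuousMap = f.toContinuousMap + g.toContinuousMap := rfl
        rw [this, map_add, add_apply, inner_add_right, Complex.add_re]
      map_smul' := fun c f => by
        have : (c • f).toContinuousMap = c • f.toContinuousMap := rfl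
        rw [this, map_smul, smul_apply, inner_smul_right_eq_smul]
        simp }
    (by
      intro f hf
      -- Positivity: `f = s* s` with `s = √f`, so `⟨ψ, f(B)ψ⟩ = ‖s(B)ψ‖²`.
      let s : C(spectrum ℝ B, ℝ) :=
        ⟨fun x => √(f x), Real.continuous_sqrt.comp f.toContinuousMap.continuous⟩
      have hs : f.toContinuousMap = star s * s := by
        ext x
        exact (Real.mul_self_sqrt (hf x)).symm
      change 0 ≤ (⟪ψ, cfcHom (R := ℝ) hB f.toContinuousMap ψ⟫_ℂ).re
      rw [hs, map_mul, map_star, ContinuousLinearMap.star_eq_adjoint,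
        mul_apply_eq_comp, ContinuousLinearMap.adjoint_inner_right]
      exact inner_self_nonneg (𝕜 := ℂ))

/-- The spectral measure of a bounded self-adjoint operator in a vector. -/
noncomputable def boundedSpectralMeasure (hB : IsSelfAdjoint B) (ψ : H) : Measure ℝ :=
  (RealRMK.rieszMeasure (spectralFunctional hB ψ)).map Subtype.val

instance (hB : IsSelfAdjoint B) (ψ : H) : IsFiniteMeasure (boundedSpectralMeasure hB ψ) := by
  unfold boundedSpectralMeasure RealRMK.rieszMeasure
  infer_instance

lemma boundedSpectralMeasure_compl_spectrum (hB : IsSelfAdjoint B) (ψ : H) :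
    boundedSpectralMeasure hB ψ (spectrum ℝ B)ᶜ = 0 := by
  rw [boundedSpectralMeasure, Measure.map_apply measurable_subtype_coe
    (spectrum.isClosed B).measurableSet.compl]
  rw [Set.preimage_compl, Subtype.coe_preimage_self, Set.compl_univ, measure_empty]

lemma ae_mem_spectrum (hB : IsSelfAdjoint B) (ψ : H) :
    ∀ᵐ x ∂(boundedSpectralMeasure hB ψ), x ∈ spectrum ℝ B :=
  boundedSpectralMeasure_compl_spectrum hB ψ

lemma integral_boundedSpectralMeasure_real (hB : IsSelfAdjoint B) (ψ : H) {f : ℝ → ℝ}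
    (hf : ContinuousOn f (spectrum ℝ B)) :
    ∫ x, f x ∂(boundedSpectralMeasure hB ψ) = (⟪ψ, cfc f B ψ⟫_ℂ).re := by
  rw [boundedSpectralMeasure, (MeasurableEmbedding.subtype_coe
    (spectrum.isClosed B).measurableSet).integral_map]
  rw [cfc_apply f B hB hf]
  exact RealRMK.integral_rieszMeasure (spectralFunctional hB ψ)
    (CompactlySupportedContinuousMap.continuousMapEquiv ⟨_, hf.domRestrict⟩)

lemma integrable_boundedSpectralMeasure {E : Type*} [NormedAddCommGroup E]
    (hB : IsSelfAdjoint B) (ψ : H) {f : ℝ → E}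
    (hf : ContinuousOn f (spectrum ℝ B)) : Integrable f (boundedSpectralMeasure hB ψ) := by
  have h : IntegrableOn f (spectrum ℝ B) (boundedSpectralMeasure hB ψ) :=
    hf.integrableOn_compact (ContinuousFunctionalCalculus.isCompact_spectrum B)
  rwa [IntegrableOn, Measure.restrict_eq_self_of_ae_mem (ae_mem_spectrum hB ψ)] at h

lemma realCfc_ofReal (hB : IsSelfAdjoint B) (f : ℝ → ℝ) :
    realCfc B (fun x => (f x : ℂ)) = cfc f B :=
  (cfc_real_eq_complex f hB).symm

lemma integral_boundedSpectralMeasure_ofReal (hB : IsSelfAdjoint B) (ψ : H) {f : ℝ → ℝ}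
    (hf : ContinuousOn f (spectrum ℝ B)) :
    ∫ x, (f x : ℂ) ∂(boundedSpectralMeasure hB ψ) = ⟪ψ, realCfc B (fun x => (f x : ℂ)) ψ⟫_ℂ := by
  rw [integral_complex_ofReal, integral_boundedSpectralMeasure_real hB ψ hf, realCfc_ofReal hB]
  have hs : IsSelfAdjoint (cfc f B) := cfc_predicate f B
  rw [ContinuousLinearMap.isSelfAdjoint_iff_isSymmetric] at hs
  exact hs.coe_re_inner_self_apply ψ

theorem integral_boundedSpectralMeasure (hB : IsSelfAdjoint B) (ψ : H) {g : ℝ → ℂ}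
    (hg : ContinuousOn g (spectrum ℝ B)) :
    ∫ x, g x ∂(boundedSpectralMeasure hB ψ) = ⟪ψ, realCfc B g ψ⟫_ℂ := by
  have hre : ContinuousOn (fun x => (g x).re) (spectrum ℝ B) :=
    Complex.continuous_re.comp_continuousOn hg
  have him : ContinuousOn (fun x => (g x).im) (spectrum ℝ B) :=
    Complex.continuous_im.comp_continuousOn hg
  have hre' : ContinuousOn (fun x => ((g x).re : ℂ)) (spectrum ℝ B) :=
    Complex.continuous_ofReal.comp_continuousOn hre
  have him' : ContinuousOn (fun x => ((g x).im : ℂ)) (spectrum ℝ B) :=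
    Complex.continuous_ofReal.comp_continuousOn him
  have hsplit : g = fun x => ((g x).re : ℂ) + Complex.I * ((g x).im : ℂ) := by
    ext x
    rw [mul_comm]
    exact (Complex.re_add_im (g x)).symm
  have hI : ContinuousOn (fun x => Complex.I * ((g x).im : ℂ)) (spectrum ℝ B) :=
    continuousOn_const.mul him'
  rw [hsplit, realCfc_add hB hre' hI, realCfc_const_mul hB _ him',
    integral_add (integrable_boundedSpectralMeasure hB ψ hre')
      (integrable_boundedSpectralMeasure hB ψ hI),
    integral_const_mul, integral_boundedSpectralMeasure_ofReal hB ψ hre,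
    integral_boundedSpectralMeasure_ofReal hB ψ him, add_apply,
    inner_add_right, smul_apply, inner_smul_right]

lemma measureReal_univ_boundedSpectralMeasure (hB : IsSelfAdjoint B) (ψ : H) :
    (boundedSpectralMeasure hB ψ).real Set.univ = ‖ψ‖ ^ 2 := by
  have h := integral_boundedSpectralMeasure_real hB ψ (f := fun _ => 1) continuousOn_const
  rw [cfc_const_one ℝ B hB, one_apply_eq_self] at h
  simpa [inner_self_eq_norm_sq_to_K, ← Complex.ofReal_pow] using h

lemma integral_norm_sq_boundedSpectralMeasure (hB : IsSelfAdjoint B) (ψ : H) {g : ℝ → ℂ}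
    (hg : ContinuousOn g (spectrum ℝ B)) :
    ∫ x, ‖g x‖ ^ 2 ∂(boundedSpectralMeasure hB ψ) = ‖realCfc B g ψ‖ ^ 2 := by
  have hc : ContinuousOn (fun x => conj (g x)) (spectrum ℝ B) :=
    Complex.continuous_conj.comp_continuousOn hg
  have h := integral_boundedSpectralMeasure hB ψ (g := fun x => conj (g x) * g x) (hc.mul hg)
  rw [realCfc_mul hB hc hg, realCfc_star, mul_apply_eq_comp,
    ContinuousLinearMap.star_eq_adjoint, ContinuousLinearMap.adjoint_inner_right,
    inner_self_eq_norm_sq_to_K] at h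
  have h2 : ∀ x, conj (g x) * g x = ((‖g x‖ ^ 2 : ℝ) : ℂ) := by
    intro x
    rw [mul_comm, Complex.mul_conj, Complex.normSq_eq_norm_sq]
  simp only [h2] at h
  rw [integral_complex_ofReal] at h
  refine Complex.ofReal_injective (h.trans ?_)
  rw [Complex.ofReal_pow]
  rfl

lemma norm_realCfc_apply_le (hB : IsSelfAdjoint B) (ψ : H) {g : ℝ → ℂ}
    (hg : ContinuousOn g (spectrum ℝ B)) {M : ℝ} (hM : 0 ≤ M)
    (hgM : ∀ x ∈ spectrum ℝ B, ‖g x‖ ≤ M) : ‖realCfc B g ψ‖ ≤ M * ‖ψ‖ := by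
  refine (sq_le_sq₀ (norm_nonneg _) (by positivity)).mp ?_
  rw [← integral_norm_sq_boundedSpectralMeasure hB ψ hg, mul_pow,
    ← measureReal_univ_boundedSpectralMeasure hB ψ]
  calc ∫ x, ‖g x‖ ^ 2 ∂(boundedSpectralMeasure hB ψ)
      ≤ ∫ _, M ^ 2 ∂(boundedSpectralMeasure hB ψ) := by
        refine integral_mono_ae (integrable_boundedSpectralMeasure hB ψ (hg.norm.pow 2))
          (integrable_const _) ?_
        filter_upwards [ae_mem_spectrum hB ψ] with x hx
        exact pow_le_pow_left₀ (norm_nonneg _) (hgM x hx) 2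
    _ = M ^ 2 * (boundedSpectralMeasure hB ψ).real Set.univ := by
        rw [integral_const, smul_eq_mul, mul_comm]

lemma dense_range_of_ker (A : H →L[ℂ] H) (h : ∀ η, star A η = 0 → η = 0) :
    Dense (Set.range A) := by
  have h1 : (LinearMap.range A.toLinearMap).topologicalClosure = ⊤ := by
    rw [Submodule.topologicalClosure_eq_top_iff, Submodule.eq_bot_iff]
    intro y hy
    refine h y (ext_inner_left ℂ fun x => ?_)
    rw [ContinuousLinearMap.star_eq_adjoint, ContinuousLinearMap.adjoint_inner_right,
      inner_zero_right]
    exact hy _ ⟨x, rfl⟩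
  have h2 := Submodule.dense_iff_topologicalClosure_eq_top.mpr h1
  exact h2

/-- A point is not an atom of the spectral measures if it is not an eigenvalue. -/
lemma boundedSpectralMeasure_singleton (hB : IsSelfAdjoint B) (ψ : H) (c : ℝ)
    (hc : ∀ η : H, B η = (c : ℂ) • η → η = 0) :
    boundedSpectralMeasure hB ψ {c} = 0 := by
  have hdense : Dense (Set.range (B - (c : ℂ) • (1 : H →L[ℂ] H))) := by
    refine dense_range_of_ker _ fun η hη => hc η ?_
    rw [star_sub, star_smul, star_one, hB.star_eq] at hη
    simpa [sub_eq_zero] using hη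
  have hid : ContinuousOn (fun x : ℝ => ((x : ℂ) + (-(c : ℂ)) * 1)) (spectrum ℝ B) := by fun_prop
  have hBc : realCfc B (fun x : ℝ => ((x : ℂ) + (-(c : ℂ)) * 1))
      = B - (c : ℂ) • (1 : H →L[ℂ] H) := by
    rw [realCfc_add hB (by fun_prop) (by fun_prop), realCfc_const_mul hB _ (by fun_prop),
      realCfc_id hB, realCfc_one hB, neg_smul, ← sub_eq_add_neg]
  -- The function `h(x) = δ/(δ + |x - c|)` equals `1` at `c`, so the mass of `{c}` is at most
  -- `‖h(B)ψ‖²`. By density, `ψ` is within `ε` of some `(B - c)η`. As `h ≤ 1`, the error contributes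
  -- at most `ε`; as `|x - c| h(x) ≤ δ`, the rest contributes at most `δ‖η‖ ≤ ε`.
  have key (ε : ℝ) (hε : 0 < ε) :
      (boundedSpectralMeasure hB ψ).real {c} ≤ (2 * ε) ^ 2 := by
    obtain ⟨_, hη, ⟨η, rfl⟩⟩ := Metric.dense_iff.mp hdense ψ ε hε
    rw [Metric.mem_ball, dist_eq_norm, norm_sub_rev] at hη
    obtain ⟨δ, hδ, hδη⟩ : ∃ δ : ℝ, 0 < δ ∧ δ * ‖η‖ ≤ ε := by
      refine ⟨ε / (‖η‖ + 1), by positivity, ?_⟩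
      rw [div_mul_eq_mul_div, div_le_iff₀ (by positivity)]
      nlinarith [norm_nonneg η]
    have hpos (x : ℝ) : 0 < δ + |x - c| := by positivity
    let h : ℝ → ℂ := fun x => ((δ / (δ + |x - c|) : ℝ) : ℂ)
    have hh : Continuous h := Complex.continuous_ofReal.comp
      (continuous_const.div (by fun_prop) fun x => (hpos x).ne')
    have hnorm (x : ℝ) : ‖h x‖ = δ / (δ + |x - c|) := by
      rw [Complex.norm_real, Real.norm_of_nonneg (div_nonneg hδ.le (hpos x).le)]
    have h1 : ‖realCfc B h (ψ - (B - (c : ℂ) • (1 : H →L[ℂ] H)) η)‖ ≤ ε := by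
      refine (norm_realCfc_apply_le hB _ hh.continuousOn zero_le_one fun x _ => ?_).trans
        (by rw [one_mul]; exact hη.le)
      rw [hnorm, div_le_one (hpos x)]
      linarith [abs_nonneg (x - c)]
    have h2 : ‖realCfc B h ((B - (c : ℂ) • (1 : H →L[ℂ] H)) η)‖ ≤ ε := by
      rw [← hBc, ← mul_apply_eq_comp, ← realCfc_mul hB hh.continuousOn hid]
      refine (norm_realCfc_apply_le hB _ (hh.continuousOn.mul hid) hδ.le fun x _ => ?_).trans hδη
      have h3 : ‖(x : ℂ) + -(c : ℂ) * 1‖ = |x - c| := by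
        rw [mul_one, ← sub_eq_add_neg, ← Complex.ofReal_sub, Complex.norm_real, Real.norm_eq_abs]
      rw [Pi.mul_apply, norm_mul, hnorm, h3, div_mul_eq_mul_div, div_le_iff₀ (hpos x)]
      nlinarith [abs_nonneg (x - c)]
    have h4 : ‖realCfc B h ψ‖ ≤ 2 * ε := by
      have : realCfc B h ψ = realCfc B h (ψ - (B - (c : ℂ) • (1 : H →L[ℂ] H)) η)
          + realCfc B h ((B - (c : ℂ) • (1 : H →L[ℂ] H)) η) := by
        rw [← map_add, sub_add_cancel]
      rw [this]
      linarith [norm_add_le (realCfc B h (ψ - (B - (c : ℂ) • (1 : H →L[ℂ] H)) η))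
        (realCfc B h ((B - (c : ℂ) • (1 : H →L[ℂ] H)) η))]
    refine le_trans ?_ (pow_le_pow_left₀ (norm_nonneg _) h4 2)
    rw [← integral_norm_sq_boundedSpectralMeasure hB ψ hh.continuousOn]
    have h5 : (boundedSpectralMeasure hB ψ).real {c}
        = ∫ x, Set.indicator {c} (fun _ => (1 : ℝ)) x ∂(boundedSpectralMeasure hB ψ) := by
      rw [integral_indicator_const _ (measurableSet_singleton c), smul_eq_mul, mul_one]
    rw [h5]
    refine integral_mono ((integrable_const _).indicator (measurableSet_singleton c))
      (integrable_boundedSpectralMeasure hB ψ (hh.continuousOn.norm.pow 2)) fun x => ?_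
    by_cases hx : x = c
    · simp [hx, h, hδ.ne']
    · simp [hx]
  have h0 : (boundedSpectralMeasure hB ψ).real {c} ≤ 0 := by
    refine le_of_forall_pos_le_add fun ε hε => ?_
    have := key (√ε / 2) (by positivity)
    rwa [mul_div_cancel₀ _ two_ne_zero, Real.sq_sqrt hε.le, ← zero_add ε] at this
  exact (measureReal_eq_zero_iff (measure_ne_top _ _)).mp (le_antisymm h0 measureReal_nonneg)

end BoundedCalculus

/-! ### Unbounded operators: uniqueness of spectral measures, construction from resolvents. -/

section SpectralMeasure

open Filter Topology

lemma sub_smul_injective_of_symmetric {T : H →ₗ.[ℂ] H} (hT : T.IsFormalAdjoint T) {z : ℂ}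
    (hz : z.im ≠ 0) {φ χ : T.domain} (h : T φ - z • (φ : H) = T χ - z • (χ : H)) : φ = χ := by
  have h1 : T (φ - χ) = z • ((φ - χ : T.domain) : H) := by
    rw [T.map_sub, Submodule.coe_sub, smul_sub, sub_eq_sub_iff_add_eq_add]
    rw [sub_eq_sub_iff_add_eq_add] at h
    rw [h, add_comm]
  have h2 := hT (φ - χ) (φ - χ)
  rw [h1, inner_smul_left, inner_smul_right] at h2
  have h3 : ⟪((φ - χ : T.domain) : H), ((φ - χ : T.domain) : H)⟫_ℂ = 0 := by
    by_contra h4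
    have h5 := congrArg Complex.im (mul_right_cancel₀ h4 h2)
    rw [Complex.conj_im] at h5
    exact hz (by linarith)
  exact sub_eq_zero.mp (Subtype.ext (inner_self_eq_zero.mp h3))

lemma IsSpectralMeasureAt.unique {T : H →ₗ.[ℂ] H} (hT : T.IsFormalAdjoint T) {ψ : H}
    {μ ν : Measure ℝ} (hμ : IsSpectralMeasureAt T ψ μ) (hν : IsSpectralMeasureAt T ψ ν) :
    μ = ν := by
  have := hμ.finite
  have := hν.finite
  refine measure_ext_of_stieltjes fun z hz => ?_
  obtain ⟨φ, hφ, hφ'⟩ := hμ.resolvent z hz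
  obtain ⟨χ, hχ, hχ'⟩ := hν.resolvent z hz
  rw [← hφ', ← hχ', sub_smul_injective_of_symmetric hT hz (hφ.trans hχ.symm)]

/-- Makes the choice in `spectralMeasureAt` harmless. Symmetry suffices: `T - z` is injective, so
the resolvent vectors, and with them the Stieltjes transform, are determined. -/
lemma spectralMeasureAt_eq {T : H →ₗ.[ℂ] H} (hT : T.IsFormalAdjoint T) {ψ : H}
    {μ : Measure ℝ} (hμ : IsSpectralMeasureAt T ψ μ) : spectralMeasureAt T ψ = μ := by
  have h : ∃ μ, IsSpectralMeasureAt T ψ μ := ⟨μ, hμ⟩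
  rw [spectralMeasureAt, dif_pos h]
  exact h.choose_spec.unique hT hμ

lemma isFormalAdjoint_of_isSelfAdjoint {K : H →ₗ.[ℂ] H} (hK : IsSelfAdjoint K) :
    K.IsFormalAdjoint K := by
  have h := LinearPMap.adjoint_isFormalAdjoint hK.dense_domain
  rwa [LinearPMap.isSelfAdjoint_def.mp hK] at h

lemma spectralMeasureAt_functionOf {f : ℝ → ℝ} {T : H →ₗ.[ℂ] H}
    (h : ∃ K, IsFunctionOf f T K) (ψ : H) :
    spectralMeasureAt (functionOf f T) ψ = (spectralMeasureAt T ψ).map f := by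
  rw [functionOf, dif_pos h]
  exact spectralMeasureAt_eq (isFormalAdjoint_of_isSelfAdjoint h.choose_spec.selfAdjoint)
    (h.choose_spec.spectral ψ)

/-- A family of bounded operators that satisfies the resolvent identity is the family of
resolvents of a self-adjoint operator. -/
theorem exists_isSelfAdjoint_of_resolvent (G : ℂ → H →L[ℂ] H)
    (hstar : star (G Complex.I) = G (-Complex.I))
    (hres : ∀ z, z.im ≠ 0 → G z = G Complex.I + (z - Complex.I) • (G Complex.I * G z))
    (hcomm : Commute (G Complex.I) (G (-Complex.I)))
    (hinj : ∀ η, G Complex.I η = 0 → η = 0) (hinj' : ∀ η, G (-Complex.I) η = 0 → η = 0) :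
    ∃ K : H →ₗ.[ℂ] H, IsSelfAdjoint K ∧ ∀ z, z.im ≠ 0 → ∀ ψ, ∃ φ : K.domain,
      (φ : H) = G z ψ ∧ K φ - z • (φ : H) = ψ := by
  have hI : Function.Injective (G Complex.I).toLinearMap :=
    (injective_iff_map_eq_zero _).mpr hinj
  let e := LinearEquiv.ofInjective (G Complex.I).toLinearMap hI
  -- `K = G(i)⁻¹ + i` on the range of `G(i)`, which is dense because `G(i)* = G(-i)` is injective.
  let K : H →ₗ.[ℂ] H :=
    { domain := LinearMap.range (G Complex.I).toLinearMap
      toFun := e.symm.toLinearMap + Complex.I • Submodule.subtype _ }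
  have hK (η : H) (hη : G Complex.I η ∈ K.domain) :
      K ⟨G Complex.I η, hη⟩ = η + Complex.I • G Complex.I η := by
    change e.symm ⟨G Complex.I η, hη⟩ + Complex.I • G Complex.I η = _
    congr 1
    rw [LinearEquiv.symm_apply_eq]
    rfl
  have hdense : Dense (K.domain : Set H) :=
    dense_range_of_ker (G Complex.I) (by rw [hstar]; exact hinj')
  have hmem (η : H) : G Complex.I η ∈ K.domain := ⟨η, rfl⟩
  have hsol (z : ℂ) (hz : z.im ≠ 0) (ψ : H) : ∃ φ : K.domain,
      (φ : H) = G z ψ ∧ K φ - z • (φ : H) = ψ := by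
    have h1 : G z ψ = G Complex.I (ψ + (z - Complex.I) • G z ψ) := by
      conv_lhs => rw [hres z hz]
      rw [add_apply, smul_apply, mul_apply_eq_comp, map_add, map_smul]
    refine ⟨⟨G Complex.I (ψ + (z - Complex.I) • G z ψ), hmem _⟩, h1.symm, ?_⟩
    change K ⟨G Complex.I (ψ + (z - Complex.I) • G z ψ), hmem _⟩
      - z • G Complex.I (ψ + (z - Complex.I) • G z ψ) = ψ
    rw [hK, ← h1, sub_smul]
    abel
  have hdiff : G Complex.I - G (-Complex.I)
      = (2 * Complex.I) • (G (-Complex.I) * G Complex.I) := by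
    have h := hres (-Complex.I) (by simp)
    rw [hcomm.eq] at h
    nth_rewrite 1 [h]
    rw [sub_add_eq_sub_sub, sub_self, zero_sub, ← neg_smul]
    congr 1
    ring
  have hsymm : K.IsFormalAdjoint K := by
    rintro ⟨_, η, rfl⟩ ⟨_, ξ, rfl⟩
    have h1 := hK η (hmem η)
    have h2 := hK ξ (hmem ξ)
    change ⟪K ⟨G Complex.I η, _⟩, G Complex.I ξ⟫_ℂ = ⟪G Complex.I η, K ⟨G Complex.I ξ, _⟩⟫_ℂ
    rw [h1, h2, inner_add_left, inner_add_right, inner_smul_left, inner_smul_right,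
      Complex.conj_I]
    have h3 : ⟪η, G Complex.I ξ⟫_ℂ - ⟪G Complex.I η, ξ⟫_ℂ
        = 2 * Complex.I * ⟪G Complex.I η, G Complex.I ξ⟫_ℂ := by
      have h4 : ∀ χ : H, ⟪G Complex.I η, χ⟫_ℂ = ⟪η, G (-Complex.I) χ⟫_ℂ := by
        intro χ
        rw [← hstar, ContinuousLinearMap.star_eq_adjoint, ContinuousLinearMap.adjoint_inner_right]
      rw [h4, h4, ← inner_sub_right, ← sub_apply, hdiff, smul_apply, inner_smul_right,
        mul_apply_eq_comp]
    linear_combination h3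
  refine ⟨K, ?_, hsol⟩
  rw [LinearPMap.isSelfAdjoint_def]
  have hle : K ≤ LinearPMap.adjoint K := hsymm.le_adjoint hdense
  refine (LinearPMap.eq_of_le_of_domain_eq hle (le_antisymm hle.1 fun y hy => ?_)).symm
  let y' : (LinearPMap.adjoint K).domain := ⟨y, hy⟩
  -- Von Neumann's criterion. With `(K + i)φ = (K* + i)y`, the vector `y - φ` lies in the kernel of
  -- `K* + i`. It is thus orthogonal to the range of `K - i`, which is everything.
  obtain ⟨φ, -, hφ⟩ := hsol (-Complex.I) (by simp)
    (LinearPMap.adjoint K y' + Complex.I • y)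
  suffices h : y - φ = 0 by rw [sub_eq_zero.mp h]; exact φ.2
  obtain ⟨χ, -, hχ⟩ := hsol Complex.I (by simp) (y - φ)
  have h1 := LinearPMap.adjoint_isFormalAdjoint hdense y' χ
  have h2 := hsymm φ χ
  have h3 : K φ + Complex.I • (φ : H) = LinearPMap.adjoint K y' + Complex.I • y := by
    rw [← hφ, neg_smul, sub_neg_eq_add]
  have h4 : LinearPMap.adjoint K y' - K φ = Complex.I • ((φ : H) - y) := by
    rw [smul_sub, sub_eq_sub_iff_add_eq_add, ← h3, add_comm]
  have h5 : ⟪y - φ, y - φ⟫_ℂ = 0 := by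
    conv_lhs => rw [← hχ]
    have h6 : ⟪y - φ, K χ⟫_ℂ = ⟪LinearPMap.adjoint K y' - K φ, (χ : H)⟫_ℂ := by
      rw [inner_sub_left, inner_sub_left, h1, h2]
    rw [hχ, ← hχ, inner_sub_right, hχ, h6, h4, inner_smul_left, inner_smul_right, Complex.conj_I,
      ← neg_sub y (φ : H), inner_neg_left]
    ring
  exact inner_self_eq_zero.mp h5

end SpectralMeasure

/-! ### The operator `-log T` through the bounded operator `(1 + T)⁻¹`. -/

section LogCalculus

open Filter Topology

/-- The bounded operator `B` is the inverse of `1 + T` for the injective positive operator `T`. -/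
structure IsInvOneAdd (T : H →ₗ.[ℂ] H) (B : H →L[ℂ] H) : Prop where
  symmetric : T.IsFormalAdjoint T
  selfAdjoint : IsSelfAdjoint B
  spectrum_subset : spectrum ℝ B ⊆ Set.Icc 0 1
  apply : ∀ η, ∃ φ : T.domain, (φ : H) = B η ∧ T φ = η - B η
  injective : ∀ η, B η = 0 → η = 0
  injective_one_sub : ∀ η, B η = η → η = 0

/-- The resolvent of `-log (b⁻¹ - 1)`, continuous on the real line. -/
noncomputable def negLogResolvent (z : ℂ) (b : ℝ) : ℂ :=
  if b ∈ Set.Ioo (0 : ℝ) 1 then ((-Real.log ((1 - b) / b) : ℝ) - z)⁻¹ else 0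

lemma tendsto_negLogResolvent (z : ℂ) {l : Filter ℝ}
    (h : Tendsto (fun b : ℝ => |Real.log ((1 - b) / b)|) l atTop) :
    Tendsto (fun b : ℝ => ((-Real.log ((1 - b) / b) : ℝ) - z)⁻¹) l (𝓝 0) := by
  refine tendsto_inv₀_cobounded.comp ?_
  rw [← tendsto_norm_atTop_iff_cobounded]
  refine tendsto_atTop_mono (fun b => ?_) (tendsto_atTop_add_const_right l (-‖z‖) h)
  have := norm_sub_norm_le ((-Real.log ((1 - b) / b) : ℝ) : ℂ) z
  rw [Complex.norm_real, norm_neg, Real.norm_eq_abs] at this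
  linarith

/-- At `0` and `1` the logarithm diverges, so the resolvent tends to the value `0` taken outside the
interval. Hence the continuous calculus of `B` suffices to construct `-log T`. -/
lemma continuous_negLogResolvent {z : ℂ} (hz : z.im ≠ 0) : Continuous (negLogResolvent z) := by
  have hdiv : ∀ b ∈ Set.Ioo (0 : ℝ) 1, 0 < (1 - b) / b := fun b hb =>
    div_pos (by linarith [hb.2]) hb.1
  have hzero : ∀ b ∉ Set.Ioo (0 : ℝ) 1, negLogResolvent z b = 0 := fun b hb => if_neg hb
  have hbdry : ∀ c ∉ Set.Ioo (0 : ℝ) 1, Tendsto (fun b : ℝ => |Real.log ((1 - b) / b)|)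
      (𝓝[Set.Ioo 0 1] c) atTop → ContinuousAt (negLogResolvent z) c := by
    intro c hc h
    rw [ContinuousAt, hzero c hc, ← nhdsWithin_univ,
      ← Set.union_compl_self (Set.Ioo (0 : ℝ) 1), nhdsWithin_union]
    refine Tendsto.sup ?_ ?_
    · refine (tendsto_negLogResolvent z h).congr' ?_
      filter_upwards [self_mem_nhdsWithin] with b hb
      exact (if_pos hb).symm
    · refine tendsto_const_nhds.congr' ?_
      filter_upwards [self_mem_nhdsWithin] with b hb
      exact (hzero b hb).symm
  rw [continuous_iff_continuousAt]
  intro c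
  by_cases hc : c ∈ Set.Ioo (0 : ℝ) 1
  · have h1 : ContinuousAt (fun b : ℝ => ((-Real.log ((1 - b) / b) : ℝ) - z)⁻¹) c := by
      refine ContinuousAt.inv₀ ?_ (ofReal_sub_ne_zero hz _)
      refine (Complex.continuous_ofReal.continuousAt.comp ?_).sub_const z
      exact (((continuousAt_const.sub continuousAt_id).div continuousAt_id hc.1.ne').log
        (hdiv c hc).ne').neg
    refine h1.congr ?_
    filter_upwards [isOpen_Ioo.mem_nhds hc] with b hb
    exact (if_pos hb).symm
  · by_cases h0 : c = 0
    · subst h0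
      refine hbdry 0 hc (tendsto_abs_atTop_atTop.comp (Real.tendsto_log_atTop.comp ?_))
      have h1 : Tendsto (fun b : ℝ => b⁻¹ + (-1)) (𝓝[Set.Ioo 0 1] 0) atTop :=
        tendsto_atTop_add_const_right _ _ (tendsto_inv_nhdsGT_zero.mono_left
          (nhdsWithin_mono _ fun b hb => hb.1))
      refine h1.congr' ?_
      filter_upwards [self_mem_nhdsWithin] with b hb
      have := hb.1.ne'
      field_simp
      ring
    · by_cases h1 : c = 1
      · subst h1
        refine hbdry 1 hc (tendsto_abs_atBot_atTop.comp (Real.tendsto_log_nhdsGT_zero.comp ?_))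
        rw [tendsto_nhdsWithin_iff]
        constructor
        · have : ContinuousAt (fun b : ℝ => (1 - b) / b) 1 :=
            (continuousAt_const.sub continuousAt_id).div continuousAt_id one_ne_zero
          have h2 := this.tendsto.mono_left (nhdsWithin_le_nhds (s := Set.Ioo 0 1))
          simpa using h2
        · filter_upwards [self_mem_nhdsWithin] with b hb using hdiv b hb
      · have h2 : c ∈ (Set.Icc (0 : ℝ) 1)ᶜ := fun h =>
          hc ⟨lt_of_le_of_ne h.1 (Ne.symm h0), lt_of_le_of_ne h.2 h1⟩
        refine continuousAt_const.congr (f := fun _ => 0) ?_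
        filter_upwards [isClosed_Icc.isOpen_compl.mem_nhds h2] with b hb
        exact (hzero b fun h => hb ⟨h.1.le, h.2.le⟩).symm

lemma negLogResolvent_eq {z w : ℂ} (hz : z.im ≠ 0) (hw : w.im ≠ 0) (b : ℝ) :
    negLogResolvent z b
      = negLogResolvent w b + (z - w) * (negLogResolvent w b * negLogResolvent z b) := by
  unfold negLogResolvent
  split_ifs with h
  · have h1 := ofReal_sub_ne_zero hz (-Real.log ((1 - b) / b))
    have h2 := ofReal_sub_ne_zero hw (-Real.log ((1 - b) / b))
    field_simp
    ring
  · simp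

lemma conj_negLogResolvent (z : ℂ) (b : ℝ) :
    conj (negLogResolvent z b) = negLogResolvent (conj z) b := by
  unfold negLogResolvent
  split_ifs with h
  · rw [map_inv₀, map_sub, Complex.conj_ofReal]
  · simp

namespace IsInvOneAdd

variable {T : H →ₗ.[ℂ] H} {B : H →L[ℂ] H}

/-- The endpoints `b = 0` and `b = 1` correspond to `x = ∞` and `x = 0`. Neither is an eigenvalue of
`B`, so neither carries mass. -/
lemma ae_mem_Ioo (h : IsInvOneAdd T B) (ψ : H) :
    ∀ᵐ b ∂(boundedSpectralMeasure h.selfAdjoint ψ), b ∈ Set.Ioo (0 : ℝ) 1 := by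
  have h0 : ∀ᵐ b ∂(boundedSpectralMeasure h.selfAdjoint ψ), b ≠ 0 := by
    refine measure_mono_null (t := {0}) (fun b hb => by simpa using hb)
      (boundedSpectralMeasure_singleton h.selfAdjoint ψ 0 fun η hη => h.injective η ?_)
    simpa using hη
  have h1 : ∀ᵐ b ∂(boundedSpectralMeasure h.selfAdjoint ψ), b ≠ 1 := by
    refine measure_mono_null (t := {1}) (fun b hb => by simpa using hb)
      (boundedSpectralMeasure_singleton h.selfAdjoint ψ 1 fun η hη => h.injective_one_sub η ?_)
    simpa using hη
  filter_upwards [ae_mem_spectrum h.selfAdjoint ψ, h0, h1] with b hb hb0 hb1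
  exact ⟨lt_of_le_of_ne (h.spectrum_subset hb).1 (Ne.symm hb0),
    lt_of_le_of_ne (h.spectrum_subset hb).2 hb1⟩

/-- The spectral measure of `T` in terms of that of `(1 + T)⁻¹`. -/
noncomputable def measure (h : IsInvOneAdd T B) (ψ : H) : Measure ℝ :=
  (boundedSpectralMeasure h.selfAdjoint ψ).map fun b => (1 - b) / b

lemma measurable_sub_div : Measurable fun b : ℝ => (1 - b) / b := by fun_prop

instance (h : IsInvOneAdd T B) (ψ : H) : IsFiniteMeasure (h.measure ψ) := by
  unfold measure; infer_instance

lemma ae_pos (h : IsInvOneAdd T B) (ψ : H) : ∀ᵐ x ∂(h.measure ψ), 0 < x := by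
  rw [measure, ae_map_iff measurable_sub_div.aemeasurable measurableSet_Ioi]
  filter_upwards [h.ae_mem_Ioo ψ] with b hb
  exact div_pos (by linarith [hb.2]) hb.1

lemma measureReal_univ (h : IsInvOneAdd T B) (ψ : H) :
    (h.measure ψ).real Set.univ = ‖ψ‖ ^ 2 := by
  rw [measure, map_measureReal_apply measurable_sub_div MeasurableSet.univ, Set.preimage_univ,
    measureReal_univ_boundedSpectralMeasure]

/-- The resolvent of `T` off the spectrum. -/
lemma resolvent (h : IsInvOneAdd T B) (ψ : H) (z : ℂ)
    (hz : ∀ b ∈ Set.Icc (0 : ℝ) 1, 1 - (1 + z) * (b : ℂ) ≠ 0) :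
    ∃ φ : T.domain, T φ - z • (φ : H) = ψ ∧
      ⟪ψ, (φ : H)⟫_ℂ = ∫ x : ℝ, ((x : ℂ) - z)⁻¹ ∂(h.measure ψ) := by
  have hB := h.selfAdjoint
  have hz' : ∀ b ∈ spectrum ℝ B, 1 - (1 + z) * (b : ℂ) ≠ 0 := fun b hb =>
    hz b (h.spectrum_subset hb)
  have hinv : ContinuousOn (fun b : ℝ => (1 - (1 + z) * (b : ℂ))⁻¹) (spectrum ℝ B) :=
    ContinuousOn.inv₀ (by fun_prop) hz'
  have hid : ContinuousOn (fun b : ℝ => (b : ℂ)) (spectrum ℝ B) := by fun_prop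
  have hmul : ContinuousOn (fun b : ℝ => (b : ℂ) * (1 - (1 + z) * (b : ℂ))⁻¹) (spectrum ℝ B) :=
    hid.mul hinv
  have hBmul : B * realCfc B (fun b : ℝ => (1 - (1 + z) * (b : ℂ))⁻¹)
      = realCfc B (fun b : ℝ => (b : ℂ) * (1 - (1 + z) * (b : ℂ))⁻¹) := by
    rw [realCfc_mul hB hid hinv, realCfc_id hB]
  -- From `TBη = η - Bη` one gets `(T - z)Bη = (1 - (1 + z)B)η`. Inverting the bounded factor gives
  -- `(T - z)⁻¹ψ = Bη`.
  set η := realCfc B (fun b : ℝ => (1 - (1 + z) * (b : ℂ))⁻¹) ψ with hη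
  obtain ⟨φ, hφ, hTφ⟩ := h.apply η
  refine ⟨φ, ?_, ?_⟩
  · have h1 : realCfc B (fun b : ℝ => (1 - (1 + z) * (b : ℂ))⁻¹)
        + (-(1 + z)) • (B * realCfc B (fun b : ℝ => (1 - (1 + z) * (b : ℂ))⁻¹)) = 1 := by
      rw [hBmul, ← realCfc_add_const_mul hB _ hinv hmul, ← realCfc_one hB]
      refine realCfc_congr hB fun b hb => ?_
      have := hz' b hb
      field_simp
      ring
    have h2 := congrArg (fun A : H →L[ℂ] H => A ψ) h1
    simp only [add_apply, smul_apply, mul_apply_eq_comp, one_apply_eq_self] at h2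
    rw [← hη] at h2
    rw [hTφ, hφ, ← h2, neg_smul, add_smul, one_smul]
    abel
  · rw [hφ, hη, ← mul_apply_eq_comp, hBmul, ← integral_boundedSpectralMeasure hB ψ hmul, measure,
      integral_map measurable_sub_div.aemeasurable (by fun_prop)]
    refine integral_congr_ae ?_
    filter_upwards [h.ae_mem_Ioo ψ] with b hb
    have hb0 : (b : ℂ) ≠ 0 := by exact_mod_cast hb.1.ne'
    have h3 := hz b ⟨hb.1.le, hb.2.le⟩
    have h4 : (((1 - b) / b : ℝ) : ℂ) - z = (1 - (1 + z) * (b : ℂ)) / b := by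
      push_cast
      field_simp
      ring
    rw [h4, inv_div, div_eq_mul_inv]

lemma one_sub_ne_zero_of_im {z : ℂ} (hz : z.im ≠ 0) (b : ℝ) :
    1 - (1 + z) * (b : ℂ) ≠ 0 := by
  intro h
  have h1 := congrArg Complex.im h
  have h2 := congrArg Complex.re h
  simp at h1 h2
  rcases h1 with h1 | h1
  · exact hz h1
  · simp [h1] at h2

lemma isSpectralMeasureAt (h : IsInvOneAdd T B) (ψ : H) :
    IsSpectralMeasureAt T ψ (h.measure ψ) where
  finite := inferInstance
  resolvent := fun z hz => h.resolvent ψ z fun b _ => one_sub_ne_zero_of_im hz b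

lemma spectralMeasureAt_eq (h : IsInvOneAdd T B) (ψ : H) :
    spectralMeasureAt T ψ = h.measure ψ :=
  RelMod.spectralMeasureAt_eq h.symmetric (h.isSpectralMeasureAt ψ)

/-- The function has no zero on `(0, 1)`, where the spectral measure of `η` lives; so if its `L²`
norm vanishes, the total mass `‖η‖²` does too. -/
lemma realCfc_negLogResolvent_injective (h : IsInvOneAdd T B) {z : ℂ} (hz : z.im ≠ 0) (η : H)
    (hη : realCfc B (negLogResolvent z) η = 0) : η = 0 := by
  have hB := h.selfAdjoint
  have hc := (continuous_negLogResolvent hz).continuousOn (s := spectrum ℝ B)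
  have h1 := integral_norm_sq_boundedSpectralMeasure hB η hc
  have hint : Integrable (fun b => ‖negLogResolvent z b‖ ^ 2)
      (boundedSpectralMeasure hB η) :=
    integrable_boundedSpectralMeasure hB η (hc.norm.pow 2)
  rw [hη, norm_zero, zero_pow two_ne_zero, integral_eq_zero_iff_of_nonneg
    (fun _ => by positivity) hint] at h1
  have h2 : ∀ᵐ b ∂(boundedSpectralMeasure hB η), False := by
    filter_upwards [h1, h.ae_mem_Ioo η] with b hb hb'
    have h3 : negLogResolvent z b = 0 := by simpa using hb
    rw [negLogResolvent, if_pos hb'] at h3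
    exact ofReal_sub_ne_zero hz _ (inv_eq_zero.mp h3)
  rw [ae_iff] at h2
  have h3 := measureReal_univ_boundedSpectralMeasure hB η
  simp only [not_false_eq_true, Set.ofPred_true] at h2
  rw [Measure.real, h2, ENNReal.toReal_zero] at h3
  simpa using h3.symm

lemma exists_isFunctionOf_neg_log (h : IsInvOneAdd T B) :
    ∃ K, IsFunctionOf (fun x => -Real.log x) T K := by
  have hB := h.selfAdjoint
  have hc {z : ℂ} (hz : z.im ≠ 0) : ContinuousOn (negLogResolvent z) (spectrum ℝ B) :=
    (continuous_negLogResolvent hz).continuousOn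
  have hI : Complex.I.im ≠ 0 := by simp
  have hI' : (-Complex.I).im ≠ 0 := by simp
  obtain ⟨K, hK, hres⟩ := exists_isSelfAdjoint_of_resolvent
    (fun z => realCfc B (negLogResolvent z)) (by
      rw [← realCfc_star]
      congr 1
      ext b
      rw [conj_negLogResolvent, Complex.conj_I]) (fun z hz => by
      have hm : ContinuousOn (fun b => negLogResolvent Complex.I b * negLogResolvent z b)
        (spectrum ℝ B) := (hc hI).mul (hc hz)
      rw [← realCfc_mul hB (hc hI) (hc hz), ← realCfc_add_const_mul hB _ (hc hI) hm]
      exact congrArg _ (funext fun b => negLogResolvent_eq hz hI b)) (cfc_commute_cfc _ _ _)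
    (h.realCfc_negLogResolvent_injective hI) (h.realCfc_negLogResolvent_injective hI')
  have hlog : Measurable fun x : ℝ => -Real.log x := Real.measurable_log.neg
  refine ⟨K, hK, fun ψ => ?_⟩
  rw [h.spectralMeasureAt_eq]
  refine ⟨inferInstance, fun z hz => ?_⟩
  obtain ⟨φ, hφ, hKφ⟩ := hres z hz ψ
  refine ⟨φ, hKφ, ?_⟩
  rw [hφ, ← integral_boundedSpectralMeasure hB ψ (hc hz), measure,
    Measure.map_map hlog measurable_sub_div,
    integral_map (hlog.comp measurable_sub_div).aemeasurable (by fun_prop)]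
  refine integral_congr_ae ?_
  filter_upwards [h.ae_mem_Ioo ψ] with b hb
  rw [negLogResolvent, if_pos hb]
  rfl

/-- The spectral measures of `-log T`. -/
theorem spectralMeasureAt_neg_log (h : IsInvOneAdd T B) (ψ : H) :
    spectralMeasureAt (functionOf (fun x => -Real.log x) T) ψ
      = (h.measure ψ).map fun x => -Real.log x := by
  rw [spectralMeasureAt_functionOf h.exists_isFunctionOf_neg_log, h.spectralMeasureAt_eq]

end IsInvOneAdd

end LogCalculus

/-! ### The positive operator `S*S` of a closed antilinear operator, and its resolvents. -/

section AdjointMul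

/-- A closed, densely defined and injective antilinear operator. -/
structure IsClosedInjective (S : H →ₛₗ.[starRingEnd ℂ] H) : Prop where
  dense : Dense (S.domain : Set H)
  closed : IsClosed {p : H × H | ∃ x : S.domain, p = ((x : H), S x)}
  injective : ∀ x : S.domain, S x = 0 → x = 0

/-- The positive operator `S* S`. -/
noncomputable def adjointMul (S : H →ₛₗ.[starRingEnd ℂ] H) : H →ₗ.[ℂ] H :=
  (adjointMulGraph S).toLinearPMap

/-- The graph of an antilinear operator as a real subspace. -/
def realGraph (S : H →ₛₗ.[starRingEnd ℂ] H) : Submodule ℝ (WithLp 2 (H × H)) where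
  carrier := {p | ∃ x : S.domain, p.fst = (x : H) ∧ p.snd = S x}
  zero_mem' := ⟨0, rfl, S.map_zero.symm⟩
  add_mem' := by
    rintro p q ⟨x, hx, hx'⟩ ⟨y, hy, hy'⟩
    exact ⟨x + y, by simp [hx, hy], by rw [S.map_add, WithLp.add_snd, hx', hy']⟩
  smul_mem' := by
    rintro c p ⟨x, hx, hx'⟩
    refine ⟨(c : ℂ) • x, by simp [hx], ?_⟩
    rw [S.map_smulₛₗ, WithLp.smul_snd, hx', Complex.conj_ofReal, Complex.coe_smul]

namespace IsClosedInjective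

variable {S : H →ₛₗ.[starRingEnd ℂ] H}

lemma isClosed_realGraph (h : IsClosedInjective S) :
    IsClosed (realGraph S : Set (WithLp 2 (H × H))) := by
  have h1 : (realGraph S : Set (WithLp 2 (H × H)))
      = (fun p : WithLp 2 (H × H) => (p.fst, p.snd)) ⁻¹'
        {p : H × H | ∃ x : S.domain, p = ((x : H), S x)} := by
    ext p
    simp [realGraph, Prod.ext_iff]
  rw [h1]
  exact h.closed.preimage ((WithLp.continuous_fst 2 H H).prodMk (WithLp.continuous_snd 2 H H))

/-- `1 + S* S` is onto. -/
lemma exists_one_add_solution (h : IsClosedInjective S) (η : H) :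
    ∃ φ : S.domain, ∀ χ : S.domain, ⟪η - (φ : H), (χ : H)⟫_ℂ = ⟪S χ, S φ⟫_ℂ := by
  let : InnerProductSpace ℝ H := InnerProductSpace.complexToReal
  have : CompleteSpace (realGraph S) := h.isClosed_realGraph.completeSpace_coe
  -- The graph of an antilinear map is only a real subspace. Orthogonality of `(η, 0) - (φ, Sφ)` to
  -- it is the real part of the claim; replacing `χ` by `iχ` gives the imaginary part.
  set p := WithLp.toLp 2 (η, (0 : H)) with hp
  obtain ⟨φ, hφ, hφ'⟩ := (realGraph S).starProjection_apply_mem p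
  have key (χ : S.domain) :
      (⟪η - (φ : H), (χ : H)⟫_ℂ).re = (⟪S χ, S φ⟫_ℂ).re := by
    have h1 := (realGraph S).starProjection_inner_eq_zero p (WithLp.toLp 2 ((χ : H), S χ))
      ⟨χ, rfl, rfl⟩
    rw [WithLp.prod_inner_apply] at h1
    simp only [WithLp.ofLp_sub, Prod.fst_sub, Prod.snd_sub] at h1
    have h2 : (WithLp.ofLp ((realGraph S).starProjection p)).1 = (φ : H) := hφ
    have h3 : (WithLp.ofLp ((realGraph S).starProjection p)).2 = S φ := hφ'
    rw [h2, h3, hp, real_inner_eq_re_inner ℂ, real_inner_eq_re_inner ℂ] at h1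
    simp only [zero_sub, inner_neg_left, map_neg] at h1
    have h4 := inner_re_symm (𝕜 := ℂ) (S φ) (S χ)
    simp only [RCLike.re_to_complex] at h1 h4
    linarith
  refine ⟨φ, fun χ => Complex.ext (key χ) ?_⟩
  have h1 := key (Complex.I • χ)
  rw [S.map_smulₛₗ, Submodule.coe_smul, inner_smul_right, inner_smul_left] at h1
  simp only [Complex.mul_re, Complex.I_re, Complex.I_im, Complex.conj_I, map_neg, zero_mul,
    one_mul, zero_sub, neg_neg] at h1
  linarith

/-- Subtracting the two equations and testing with the difference gives `‖φ' - φ‖² = -‖S(φ' - φ)‖²`.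
-/
lemma one_add_solution_unique {η : H} {φ φ' : S.domain}
    (h1 : ∀ χ : S.domain, ⟪η - (φ : H), (χ : H)⟫_ℂ = ⟪S χ, S φ⟫_ℂ)
    (h2 : ∀ χ : S.domain, ⟪η - (φ' : H), (χ : H)⟫_ℂ = ⟪S χ, S φ'⟫_ℂ) : φ = φ' := by
  have h3 : ⟪((φ' - φ : S.domain) : H), ((φ' - φ : S.domain) : H)⟫_ℂ
      = -⟪S (φ' - φ), S (φ' - φ)⟫_ℂ := by
    have h4 := h1 (φ' - φ)
    have h5 := h2 (φ' - φ)
    have h6 : ((φ' - φ : S.domain) : H) = (η - (φ : H)) - (η - (φ' : H)) := by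
      rw [Submodule.coe_sub]; abel
    conv_lhs => enter [2]; rw [h6]
    rw [inner_sub_left, h4, h5, ← inner_sub_right, ← S.map_sub, ← neg_sub φ' φ, S.map_neg,
      inner_neg_right]
  have h7 := congrArg Complex.re h3
  have h8 := inner_self_nonneg (𝕜 := ℂ) (x := S (φ' - φ))
  have h9 := inner_self_nonneg (𝕜 := ℂ) (x := ((φ' - φ : S.domain) : H))
  simp only [RCLike.re_to_complex] at h8 h9
  rw [Complex.neg_re] at h7
  have h10 : (⟪((φ' - φ : S.domain) : H), ((φ' - φ : S.domain) : H)⟫_ℂ).re = 0 := by linarith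
  have h11 : ((φ' - φ : S.domain) : H) = 0 := (by
    have h12 := inner_self_eq_norm_sq (𝕜 := ℂ) ((φ' - φ : S.domain) : H)
    simp only [RCLike.re_to_complex] at h12
    rw [h10] at h12
    simpa using h12.symm)
  exact (sub_eq_zero.mp (Subtype.ext h11)).symm

/-- `(1 + S* S)⁻¹` with values in the domain of `S`. -/
noncomputable def oneAddInvLinear (h : IsClosedInjective S) : H →ₗ[ℂ] S.domain where
  toFun η := (h.exists_one_add_solution η).choose
  map_add' η ξ := by
    refine one_add_solution_unique (h.exists_one_add_solution (η + ξ)).choose_spec fun χ => ?_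
    rw [S.map_add, inner_add_right, ← (h.exists_one_add_solution η).choose_spec χ,
      ← (h.exists_one_add_solution ξ).choose_spec χ, ← inner_add_left, Submodule.coe_add]
    congr 1
    abel
  map_smul' c η := by
    refine one_add_solution_unique (h.exists_one_add_solution (c • η)).choose_spec fun χ => ?_
    rw [S.map_smulₛₗ, RingHom.id_apply, inner_smul_right,
      ← (h.exists_one_add_solution η).choose_spec χ, ← inner_smul_left, Submodule.coe_smul,
      smul_sub]

lemma oneAddInvLinear_spec (h : IsClosedInjective S) (η : H) (χ : S.domain) :
    ⟪η - (h.oneAddInvLinear η : H), (χ : H)⟫_ℂ = ⟪S χ, S (h.oneAddInvLinear η)⟫_ℂ :=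
  (h.exists_one_add_solution η).choose_spec χ

lemma norm_oneAddInvLinear_le (h : IsClosedInjective S) (η : H) :
    ‖(h.oneAddInvLinear η : H)‖ ≤ ‖η‖ := by
  set φ := h.oneAddInvLinear η with hφ
  have h1 := congrArg Complex.re (h.oneAddInvLinear_spec η φ)
  rw [← hφ, inner_sub_left, Complex.sub_re] at h1
  have h2 := inner_self_nonneg (𝕜 := ℂ) (x := S φ)
  have h3 := inner_self_eq_norm_sq (𝕜 := ℂ) (φ : H)
  have h4 := re_inner_le_norm (𝕜 := ℂ) η (φ : H)
  simp only [RCLike.re_to_complex] at h2 h3 h4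
  by_contra! h5
  nlinarith [norm_nonneg η, norm_nonneg (φ : H)]

/-- The bounded operator `(1 + S* S)⁻¹`. -/
noncomputable def oneAddInv (h : IsClosedInjective S) : H →L[ℂ] H :=
  LinearMap.mkContinuous (S.domain.subtype ∘ₗ h.oneAddInvLinear) 1
    (fun η => by rw [one_mul]; exact h.norm_oneAddInvLinear_le η)

lemma oneAddInv_apply (h : IsClosedInjective S) (η : H) :
    h.oneAddInv η = (h.oneAddInvLinear η : H) := rfl

lemma graph_fst_eq_zero (h : IsClosedInjective S) (x : H × H) (hx : x ∈ adjointMulGraph S)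
    (hx' : x.1 = 0) : x.2 = 0 := by
  obtain ⟨ψ, hψ, hψ'⟩ := hx
  have h0 : ψ = 0 := Subtype.ext (hψ.trans hx')
  refine h.dense.eq_zero_of_inner_left ℂ fun χ hχ => ?_
  have := hψ' ⟨χ, hχ⟩
  rwa [h0, S.map_zero, inner_zero_right] at this

lemma adjointMul_spec (h : IsClosedInjective S) (x : (adjointMul S).domain) :
    ∃ ψ : S.domain, (ψ : H) = x ∧
      ∀ χ : S.domain, ⟪adjointMul S x, (χ : H)⟫_ℂ = ⟪S χ, S ψ⟫_ℂ :=
  (adjointMulGraph S).mem_graph_toLinearPMap h.graph_fst_eq_zero x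

lemma exists_adjointMul_eq (h : IsClosedInjective S) (ψ : S.domain) (y : H)
    (hy : ∀ χ : S.domain, ⟪y, (χ : H)⟫_ℂ = ⟪S χ, S ψ⟫_ℂ) :
    ∃ x : (adjointMul S).domain, (x : H) = ψ ∧ adjointMul S x = y := by
  have h1 : ((ψ : H), y) ∈ (adjointMul S).graph := by
    rw [adjointMul, Submodule.toLinearPMap_graph_eq _ h.graph_fst_eq_zero]
    exact ⟨ψ, rfl, hy⟩
  exact (LinearPMap.mem_graph_iff _).mp h1

lemma adjointMul_symmetric (h : IsClosedInjective S) :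
    (adjointMul S).IsFormalAdjoint (adjointMul S) := by
  intro x y
  obtain ⟨φ, hφ, hφ'⟩ := h.adjointMul_spec x
  obtain ⟨χ, hχ, hχ'⟩ := h.adjointMul_spec y
  rw [← hχ, hφ', ← hφ, ← inner_conj_symm (φ : H), hχ', inner_conj_symm]

lemma oneAddInv_symmetric (h : IsClosedInjective S) (η ξ : H) :
    ⟪h.oneAddInv η, ξ⟫_ℂ = ⟪η, h.oneAddInv ξ⟫_ℂ := by
  have h1 := h.oneAddInvLinear_spec η (h.oneAddInvLinear ξ)
  have h2 := h.oneAddInvLinear_spec ξ (h.oneAddInvLinear η)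
  rw [← inner_conj_symm, ← inner_conj_symm (S _)] at h2
  have h3 := (starRingEnd ℂ).injective h2
  rw [← h3, inner_sub_left, inner_sub_right] at h1
  rw [oneAddInv_apply, oneAddInv_apply]
  linear_combination -h1

lemma isSelfAdjoint_oneAddInv (h : IsClosedInjective S) : IsSelfAdjoint h.oneAddInv :=
  ContinuousLinearMap.isSelfAdjoint_iff_isSymmetric.mpr h.oneAddInv_symmetric

/-- This identity expresses `B - B² ≥ 0` for `B = (1 + S*S)⁻¹`; it yields `0 ≤ B ≤ 1` and, as `S` is
injective, the injectivity of `1 - B`. -/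
lemma re_inner_oneAddInv (h : IsClosedInjective S) (η : H) :
    (⟪η - h.oneAddInv η, h.oneAddInv η⟫_ℂ).re = ‖S (h.oneAddInvLinear η)‖ ^ 2 := by
  rw [oneAddInv_apply, h.oneAddInvLinear_spec]
  exact inner_self_eq_norm_sq (𝕜 := ℂ) _

lemma oneAddInv_nonneg (h : IsClosedInjective S) : 0 ≤ h.oneAddInv := by
  rw [ContinuousLinearMap.nonneg_iff_isPositive, ContinuousLinearMap.isPositive_def']
  refine ⟨h.isSelfAdjoint_oneAddInv, fun η => ?_⟩
  have h1 := h.re_inner_oneAddInv η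
  have h2 := inner_self_eq_norm_sq (𝕜 := ℂ) (h.oneAddInv η)
  rw [inner_sub_left, Complex.sub_re] at h1
  rw [ContinuousLinearMap.reApplyInnerSelf_apply, h.oneAddInv_symmetric]
  simp only [RCLike.re_to_complex] at h2 ⊢
  nlinarith [sq_nonneg ‖S (h.oneAddInvLinear η)‖, sq_nonneg ‖h.oneAddInv η‖]

lemma oneAddInv_le_one (h : IsClosedInjective S) : h.oneAddInv ≤ 1 := by
  rw [ContinuousLinearMap.le_def, ContinuousLinearMap.isPositive_def']
  refine ⟨(IsSelfAdjoint.one _).sub h.isSelfAdjoint_oneAddInv, fun η => ?_⟩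
  have h1 := h.re_inner_oneAddInv η
  have h2 := inner_self_eq_norm_sq (𝕜 := ℂ) (η - h.oneAddInv η)
  rw [inner_sub_right] at h2
  rw [ContinuousLinearMap.reApplyInnerSelf_apply, sub_apply, one_apply_eq_self]
  simp only [RCLike.re_to_complex, Complex.sub_re] at h2 ⊢
  nlinarith [sq_nonneg ‖S (h.oneAddInvLinear η)‖, sq_nonneg ‖η - h.oneAddInv η‖]

theorem isInvOneAdd (h : IsClosedInjective S) : IsInvOneAdd (adjointMul S) h.oneAddInv where
  symmetric := h.adjointMul_symmetric
  selfAdjoint := h.isSelfAdjoint_oneAddInv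
  spectrum_subset := fun x hx =>
    ⟨spectrum_nonneg_of_nonneg h.oneAddInv_nonneg hx,
      (CFC.le_one_iff (R := ℝ) h.oneAddInv h.isSelfAdjoint_oneAddInv).mp h.oneAddInv_le_one x hx⟩
  apply := fun η => h.exists_adjointMul_eq (h.oneAddInvLinear η) _ (h.oneAddInvLinear_spec η)
  injective := by
    intro η hη
    have h0 : h.oneAddInvLinear η = 0 := Subtype.ext hη
    refine h.dense.eq_zero_of_inner_left ℂ fun χ hχ => ?_
    have h1 := h.oneAddInvLinear_spec η ⟨χ, hχ⟩
    rwa [h0, S.map_zero, inner_zero_right, Submodule.coe_zero, sub_zero] at h1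
  injective_one_sub := by
    intro η hη
    have h1 := h.re_inner_oneAddInv η
    rw [hη, sub_self, inner_zero_left, Complex.zero_re] at h1
    have h2 : S (h.oneAddInvLinear η) = 0 := by simpa using h1.symm
    have h3 := congrArg Subtype.val (h.injective _ h2)
    exact hη.symm.trans h3

/-- The resolvent of `S* S` at a negative number solves a variational problem. -/
lemma exists_resolvent_solution (h : IsClosedInjective S) (ψ : H) {t : ℝ} (ht : 0 < t) :
    ∃ φ : S.domain, (∀ χ : S.domain,
        (⟪ψ, (χ : H)⟫_ℂ).re = (⟪S χ, S φ⟫_ℂ).re + t * (⟪(φ : H), (χ : H)⟫_ℂ).re) ∧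
      ∫ x, (x + t)⁻¹ ∂(spectralMeasureAt (adjointMul S) ψ) = (⟪ψ, (φ : H)⟫_ℂ).re := by
  -- At `z = -t` the quantity is `(1 - b) + tb`, positive on `[0, 1]`.
  have hz : ∀ b ∈ Set.Icc (0 : ℝ) 1, 1 - (1 + ((-t : ℝ) : ℂ)) * (b : ℂ) ≠ 0 := by
    intro b hb h0
    have h1 : (1 - (1 + (-t)) * b : ℝ) = 0 := by exact_mod_cast h0
    rcases hb.1.eq_or_lt with h2 | h2
    · rw [← h2] at h1; simp at h1
    · nlinarith [hb.2, mul_pos ht h2]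
  obtain ⟨x, hx, hx'⟩ := h.isInvOneAdd.resolvent ψ ((-t : ℝ) : ℂ) hz
  obtain ⟨φ, hφ, hφ'⟩ := h.adjointMul_spec x
  refine ⟨φ, fun χ => ?_, ?_⟩
  · rw [← hx, inner_sub_left, hφ', inner_smul_left, Complex.conj_ofReal, Complex.sub_re,
      Complex.re_ofReal_mul, hφ]
    ring
  · rw [hφ, hx', h.isInvOneAdd.spectralMeasureAt_eq]
    have h1 : ∀ y : ℝ, ((y : ℂ) - ((-t : ℝ) : ℂ))⁻¹ = (((y + t)⁻¹ : ℝ) : ℂ) := by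
      intro y
      push_cast
      rw [sub_neg_eq_add]
    simp only [h1]
    rw [integral_complex_ofReal, Complex.ofReal_re]

/-- Completing the square: with `φ = (S*S + t)⁻¹ψ` the right side exceeds the left by `‖Sχ - Sφ‖² +
t‖χ - φ‖²`. -/
lemma le_integral_resolvent (h : IsClosedInjective S) (ψ : H) {t : ℝ} (ht : 0 < t)
    (χ : S.domain) :
    2 * (⟪ψ, (χ : H)⟫_ℂ).re - ‖S χ‖ ^ 2 - t * ‖(χ : H)‖ ^ 2
      ≤ ∫ x, (x + t)⁻¹ ∂(spectralMeasureAt (adjointMul S) ψ) := by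
  obtain ⟨φ, hφ, hφ'⟩ := h.exists_resolvent_solution ψ ht
  have h1 := hφ φ
  have h2 := hφ χ
  have h3 := norm_sub_sq (𝕜 := ℂ) (S χ) (S φ)
  have h4 := norm_sub_sq (𝕜 := ℂ) (φ : H) (χ : H)
  have h5 := inner_self_eq_norm_sq (𝕜 := ℂ) (φ : H)
  have h6 := inner_self_eq_norm_sq (𝕜 := ℂ) (S φ)
  simp only [RCLike.re_to_complex] at h3 h4 h5 h6
  rw [hφ', h2, h1]
  nlinarith [sq_nonneg ‖S χ - S φ‖, mul_nonneg ht.le (sq_nonneg ‖(φ : H) - (χ : H)‖)]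

/-- Monotonicity of the resolvents of `S* S` under extensions. -/
theorem integral_resolvent_mono {S₁ S₂ : H →ₛₗ.[starRingEnd ℂ] H} (h₁ : IsClosedInjective S₁)
    (h₂ : IsClosedInjective S₂) {ψ₁ ψ₂ : H}
    (hS : ∀ x : S₁.domain, ∃ y : S₂.domain,
      ‖S₂ y‖ = ‖S₁ x‖ ∧ ‖(y : H)‖ = ‖(x : H)‖ ∧ ⟪ψ₂, (y : H)⟫_ℂ = ⟪ψ₁, (x : H)⟫_ℂ)
    {t : ℝ} (ht : 0 < t) :
    ∫ x, (x + t)⁻¹ ∂(spectralMeasureAt (adjointMul S₁) ψ₁)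
      ≤ ∫ x, (x + t)⁻¹ ∂(spectralMeasureAt (adjointMul S₂) ψ₂) := by
  obtain ⟨φ, hφ, hφ'⟩ := h₁.exists_resolvent_solution ψ₁ ht
  obtain ⟨χ, hχ, hχ', hχψ⟩ := hS φ
  -- The maximizer for `S₁`, transported to the domain of `S₂`, is a trial vector there with the
  -- same value.
  refine le_trans ?_ (h₂.le_integral_resolvent ψ₂ ht χ)
  have h1 := hφ φ
  have h5 := inner_self_eq_norm_sq (𝕜 := ℂ) (φ : H)
  have h6 := inner_self_eq_norm_sq (𝕜 := ℂ) (S₁ φ)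
  simp only [RCLike.re_to_complex] at h5 h6
  rw [h5, h6] at h1
  rw [hφ', hχ, hχ', hχψ]
  linarith

end IsClosedInjective

end AdjointMul

/-! ### Logarithms as integrals of resolvents. -/

section LogIntegrals

open Set

lemma integral_inv_add {x : ℝ} (hx : 0 < x) : ∫ t in (0 : ℝ)..1, (x + t)⁻¹ = Real.log (1 + x⁻¹) := by
  have h := intervalIntegral.integral_comp_add_left (a := 0) (b := 1) (fun t : ℝ => t⁻¹) x
  rw [h, integral_inv_of_pos (by linarith) (by linarith)]
  congr 1
  field_simp
  ring

lemma integral_div_one_add_mul {x : ℝ} (hx : 0 < x) :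
    ∫ s in (0 : ℝ)..1, x / (1 + s * x) = Real.log (1 + x) := by
  have hpos : ∀ s ∈ uIcc (0 : ℝ) 1, 0 < 1 + s * x := by
    intro s hs
    rw [uIcc_of_le zero_le_one] at hs
    have := mul_nonneg hs.1 hx.le
    linarith
  have h : ∀ s ∈ uIcc (0 : ℝ) 1, HasDerivAt (fun s => Real.log (1 + s * x)) (x / (1 + s * x)) s := by
    intro s hs
    have h1 : HasDerivAt (fun s : ℝ => 1 + s * x) x s := by
      simpa using ((hasDerivAt_id s).mul_const x).const_add 1
    exact h1.log (hpos s hs).ne'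
  rw [intervalIntegral.integral_eq_sub_of_hasDerivAt h]
  · simp
  · refine ContinuousOn.intervalIntegrable ?_
    exact continuousOn_const.div (by fun_prop) fun s hs => (hpos s hs).ne'

lemma lintegral_inv_add {x : ℝ} (hx : 0 < x) :
    ∫⁻ t in Ioc (0 : ℝ) 1, ENNReal.ofReal (x + t)⁻¹ = ENNReal.ofReal (Real.log (1 + x⁻¹)) := by
  rw [← integral_inv_add hx, intervalIntegral.integral_of_le zero_le_one,
    ofReal_integral_eq_lintegral_ofReal]
  · refine (ContinuousOn.integrableOn_Icc (f := fun t => (x + t)⁻¹) ?_).mono_set Ioc_subset_Icc_self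
    exact ContinuousOn.inv₀ (by fun_prop) fun t ht => by linarith [ht.1]
  · filter_upwards [ae_restrict_mem measurableSet_Ioc] with t ht
    exact inv_nonneg.mpr (by linarith [ht.1])

lemma lintegral_div_one_add_mul {x : ℝ} (hx : 0 < x) :
    ∫⁻ s in Ioc (0 : ℝ) 1, ENNReal.ofReal (x / (1 + s * x))
      = ENNReal.ofReal (Real.log (1 + x)) := by
  have hpos : ∀ s : ℝ, 0 ≤ s → 0 < 1 + s * x := fun s hs => by
    have := mul_nonneg hs hx.le
    linarith
  rw [← integral_div_one_add_mul hx, intervalIntegral.integral_of_le zero_le_one,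
    ofReal_integral_eq_lintegral_ofReal]
  · refine (ContinuousOn.integrableOn_Icc (f := fun s => x / (1 + s * x)) ?_).mono_set
      Ioc_subset_Icc_self
    exact continuousOn_const.div (by fun_prop) fun t ht => (hpos t ht.1).ne'
  · filter_upwards [ae_restrict_mem measurableSet_Ioc] with t ht
    exact div_nonneg hx.le (hpos t ht.1.le).le

variable (μ : Measure ℝ) [IsFiniteMeasure μ] (hμ : ∀ᵐ x ∂μ, 0 < x)

include hμ

lemma integrable_inv_add {t : ℝ} (ht : 0 < t) : Integrable (fun x => (x + t)⁻¹) μ := by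
  refine Integrable.of_bound (by fun_prop) t⁻¹ ?_
  filter_upwards [hμ] with x hx
  rw [Real.norm_of_nonneg (by positivity)]
  exact inv_anti₀ ht (by linarith)

lemma lintegral_log_one_add_inv :
    ∫⁻ x, ENNReal.ofReal (Real.log (1 + x⁻¹)) ∂μ
      = ∫⁻ t in Ioc (0 : ℝ) 1, ENNReal.ofReal (∫ x, (x + t)⁻¹ ∂μ) := by
  have h1 : ∫⁻ x, ENNReal.ofReal (Real.log (1 + x⁻¹)) ∂μ
      = ∫⁻ x, (∫⁻ t in Ioc (0 : ℝ) 1, ENNReal.ofReal (x + t)⁻¹) ∂μ := by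
    refine lintegral_congr_ae ?_
    filter_upwards [hμ] with x hx using (lintegral_inv_add hx).symm
  rw [h1, lintegral_lintegral_swap (by fun_prop)]
  refine setLIntegral_congr_fun measurableSet_Ioc fun t ht => ?_
  refine (ofReal_integral_eq_lintegral_ofReal (integrable_inv_add μ hμ ht.1) ?_).symm
  filter_upwards [hμ] with x hx
  exact inv_nonneg.mpr (add_pos hx ht.1).le

/-- Rests on `x/(1 + sx) = s⁻¹ - s⁻²(x + s⁻¹)⁻¹`. The resolvent enters with a minus sign, so this
part is antitone in it. -/
lemma lintegral_log_one_add :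
    ∫⁻ x, ENNReal.ofReal (Real.log (1 + x)) ∂μ
      = ∫⁻ s in Ioc (0 : ℝ) 1,
        ENNReal.ofReal (s⁻¹ * μ.real univ - s⁻¹ ^ 2 * ∫ x, (x + s⁻¹)⁻¹ ∂μ) := by
  have h1 : ∫⁻ x, ENNReal.ofReal (Real.log (1 + x)) ∂μ
      = ∫⁻ x, (∫⁻ s in Ioc (0 : ℝ) 1, ENNReal.ofReal (x / (1 + s * x))) ∂μ := by
    refine lintegral_congr_ae ?_
    filter_upwards [hμ] with x hx using (lintegral_div_one_add_mul hx).symm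
  rw [h1, lintegral_lintegral_swap (by fun_prop)]
  refine setLIntegral_congr_fun measurableSet_Ioc fun s hs => ?_
  have hi := integrable_inv_add μ hμ (inv_pos.mpr hs.1)
  have h2 : ∀ᵐ x ∂μ, x / (1 + s * x) = s⁻¹ - s⁻¹ ^ 2 * (x + s⁻¹)⁻¹ := by
    filter_upwards [hμ] with x hx
    have hs0 : s ≠ 0 := hs.1.ne'
    have h3 : 1 + s * x ≠ 0 := by have := mul_pos hs.1 hx; positivity
    have h4 : x + s⁻¹ = (1 + s * x) / s := by
      field_simp
      ring
    rw [h4, inv_div, div_eq_iff h3, sub_mul, mul_assoc (s⁻¹ ^ 2), div_mul_cancel₀ _ h3]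
    field_simp
    ring
  have h3 : s⁻¹ * μ.real univ - s⁻¹ ^ 2 * ∫ x, (x + s⁻¹)⁻¹ ∂μ = ∫ x, x / (1 + s * x) ∂μ := by
    rw [integral_congr_ae h2, integral_sub (integrable_const _) (hi.const_mul _),
      integral_const, integral_const_mul, smul_eq_mul, mul_comm (s⁻¹)]
  change _ = ENNReal.ofReal _
  rw [h3, ofReal_integral_eq_lintegral_ofReal]
  · exact (((integrable_const _).sub (hi.const_mul _)).congr (h2.mono fun _ h => h.symm))
  · filter_upwards [hμ] with x hx
    have := mul_pos hs.1 hx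
    positivity

/-- The common difference between `log (1 + x)` and `log x` for `x > 1`, and between
`log (1 + x⁻¹)` and `-log x` for `x < 1`. -/
lemma exists_log_correction :
    ∃ C : ℝ≥0∞, C ≠ ⊤ ∧
      (∫⁻ x, ENNReal.ofReal (-Real.log x) ∂μ) + C
        = ∫⁻ x, ENNReal.ofReal (Real.log (1 + x⁻¹)) ∂μ ∧
      (∫⁻ x, ENNReal.ofReal (Real.log x) ∂μ) + C
        = ∫⁻ x, ENNReal.ofReal (Real.log (1 + x)) ∂μ := by
  have hmeas : Measurable fun x : ℝ =>
      ENNReal.ofReal (min (Real.log (1 + x)) (Real.log (1 + x⁻¹))) :=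
    ENNReal.measurable_ofReal.comp ((Real.measurable_log.comp (by fun_prop)).min
      (Real.measurable_log.comp (by fun_prop)))
  have hlog : ∀ x : ℝ, 0 < x → Real.log (1 + x⁻¹) = Real.log (1 + x) - Real.log x := by
    intro x hx
    rw [← Real.log_div (by positivity) hx.ne']
    congr 1
    field_simp
    ring
  have h1 : ∀ x : ℝ, 0 < x → 0 ≤ Real.log (1 + x) := fun x hx => Real.log_nonneg (by linarith)
  have h2 : ∀ x : ℝ, 0 < x → 0 ≤ Real.log (1 + x⁻¹) := fun x hx =>
    Real.log_nonneg (by have := inv_pos.mpr hx; linarith)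
  -- The positive part of `p - q` is `p - min p q` and the negative part is `q - min p q`, with `p =
  -- log (1 + x⁻¹)` and `q = log (1 + x)`. The minimum is at most `log 2`.
  refine ⟨∫⁻ x, ENNReal.ofReal (min (Real.log (1 + x)) (Real.log (1 + x⁻¹))) ∂μ, ?_, ?_, ?_⟩
  · refine ne_top_of_le_ne_top (b := ∫⁻ _, ENNReal.ofReal (Real.log 2) ∂μ) ?_
      (lintegral_mono_ae ?_)
    · rw [lintegral_const]
      exact ENNReal.mul_ne_top ENNReal.ofReal_ne_top (measure_ne_top _ _)
    · filter_upwards [hμ] with x hx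
      refine ENNReal.ofReal_le_ofReal ?_
      rcases le_total x 1 with h | h
      · exact (min_le_left _ _).trans (Real.log_le_log (by linarith) (by linarith))
      · have := inv_le_one_of_one_le₀ h
        exact (min_le_right _ _).trans (Real.log_le_log (by positivity) (by linarith))
  · rw [← lintegral_add_right _ hmeas]
    refine lintegral_congr_ae ?_
    filter_upwards [hμ] with x hx
    rcases le_total x 1 with h | h
    · have h3 := Real.log_nonpos hx.le h
      rw [min_eq_left (by rw [hlog x hx]; linarith), ← ENNReal.ofReal_add (by linarith) (h1 x hx),
        hlog x hx]
      congr 1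
      ring
    · have h3 := Real.log_nonneg h
      rw [min_eq_right (by rw [hlog x hx]; linarith), ENNReal.ofReal_of_nonpos (by linarith),
        zero_add]
  · rw [← lintegral_add_right _ hmeas]
    refine lintegral_congr_ae ?_
    filter_upwards [hμ] with x hx
    rcases le_total x 1 with h | h
    · have h3 := Real.log_nonpos hx.le h
      rw [min_eq_left (by rw [hlog x hx]; linarith), ENNReal.ofReal_of_nonpos h3, zero_add]
    · have h3 := Real.log_nonneg h
      rw [min_eq_right (by rw [hlog x hx]; linarith), ← ENNReal.ofReal_add h3 (h2 x hx),
        hlog x hx]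
      congr 1
      ring

end LogIntegrals

lemma ereal_sub_add_right_cancel (a b : ℝ≥0∞) {c : ℝ≥0∞} (hc : c ≠ ⊤) :
    ((a + c : ℝ≥0∞) : EReal) - ((b + c : ℝ≥0∞) : EReal) = (a : EReal) - (b : EReal) := by
  lift c to NNReal using hc
  induction b using ENNReal.recTopCoe with
  | top => simp
  | coe b =>
    induction a using ENNReal.recTopCoe with
    | top =>
      rw [← ENNReal.coe_add, top_add]
      rfl
    | coe a =>
      rw [← ENNReal.coe_add, ← ENNReal.coe_add]
      change (((a + c : NNReal) : ℝ) : EReal) - (((b + c : NNReal) : ℝ) : EReal)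
        = ((a : ℝ) : EReal) - ((b : ℝ) : EReal)
      rw [← EReal.coe_sub, ← EReal.coe_sub]
      congr 1
      push_cast
      ring

/-! ### Quadratic forms of `-log S*S` and their monotonicity. -/

section Forms

/-- The operator `-log S* S`. -/
noncomputable def negLogAdjointMul (S : H →ₛₗ.[starRingEnd ℂ] H) : H →ₗ.[ℂ] H :=
  functionOf (fun x => -Real.log x) (adjointMul S)

namespace IsClosedInjective

variable {S S₁ S₂ : H →ₛₗ.[starRingEnd ℂ] H}

lemma isFiniteMeasure (h : IsClosedInjective S) (ψ : H) :
    IsFiniteMeasure (spectralMeasureAt (adjointMul S) ψ) := by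
  rw [h.isInvOneAdd.spectralMeasureAt_eq]
  infer_instance

lemma ae_pos (h : IsClosedInjective S) (ψ : H) :
    ∀ᵐ x ∂(spectralMeasureAt (adjointMul S) ψ), 0 < x := by
  rw [h.isInvOneAdd.spectralMeasureAt_eq]
  exact h.isInvOneAdd.ae_pos ψ

lemma measureReal_univ (h : IsClosedInjective S) (ψ : H) :
    (spectralMeasureAt (adjointMul S) ψ).real Set.univ = ‖ψ‖ ^ 2 := by
  rw [h.isInvOneAdd.spectralMeasureAt_eq]
  exact h.isInvOneAdd.measureReal_univ ψ

lemma spectralMeasureAt_negLog (h : IsClosedInjective S) (ψ : H) :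
    spectralMeasureAt (negLogAdjointMul S) ψ
      = (spectralMeasureAt (adjointMul S) ψ).map fun x => -Real.log x := by
  rw [negLogAdjointMul, h.isInvOneAdd.spectralMeasureAt_neg_log,
    h.isInvOneAdd.spectralMeasureAt_eq]

lemma posForm_negLog (h : IsClosedInjective S) (ψ : H) :
    posForm (negLogAdjointMul S) ψ
      = ∫⁻ x, ENNReal.ofReal (-Real.log x) ∂(spectralMeasureAt (adjointMul S) ψ) := by
  have hlog : Measurable fun x : ℝ => -Real.log x := Real.measurable_log.neg
  rw [posForm, h.spectralMeasureAt_negLog, lintegral_map ENNReal.measurable_ofReal hlog]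

lemma negForm_negLog (h : IsClosedInjective S) (ψ : H) :
    negForm (negLogAdjointMul S) ψ
      = ∫⁻ x, ENNReal.ofReal (Real.log x) ∂(spectralMeasureAt (adjointMul S) ψ) := by
  have hlog : Measurable fun x : ℝ => -Real.log x := Real.measurable_log.neg
  have hneg : Measurable fun x : ℝ => ENNReal.ofReal (-x) :=
    ENNReal.measurable_ofReal.comp measurable_neg
  rw [negForm, h.spectralMeasureAt_negLog, lintegral_map hneg hlog]
  simp only [neg_neg]

/-- The form of `-log S* S` as a difference of forms of operator monotone functions. -/
lemma exists_form_correction (h : IsClosedInjective S) (ψ : H) :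
    ∃ C : ℝ≥0∞, C ≠ ⊤ ∧
      posForm (negLogAdjointMul S) ψ + C = (∫⁻ t in Set.Ioc (0 : ℝ) 1,
        ENNReal.ofReal (∫ x, (x + t)⁻¹ ∂(spectralMeasureAt (adjointMul S) ψ))) ∧
      negForm (negLogAdjointMul S) ψ + C = (∫⁻ s in Set.Ioc (0 : ℝ) 1,
        ENNReal.ofReal (s⁻¹ * ‖ψ‖ ^ 2
          - s⁻¹ ^ 2 * ∫ x, (x + s⁻¹)⁻¹ ∂(spectralMeasureAt (adjointMul S) ψ))) := by
  have := h.isFiniteMeasure ψ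
  obtain ⟨C, hC, h1, h2⟩ := exists_log_correction _ (h.ae_pos ψ)
  refine ⟨C, hC, ?_, ?_⟩
  · rw [h.posForm_negLog, h1, lintegral_log_one_add_inv _ (h.ae_pos ψ)]
  · rw [h.negForm_negLog, h2, lintegral_log_one_add _ (h.ae_pos ψ), h.measureReal_univ]

/-- Operator monotonicity of the logarithm for the operators `S* S`. -/
theorem negLog_mono (h₁ : IsClosedInjective S₁) (h₂ : IsClosedInjective S₂) {ψ₁ ψ₂ : H}
    (hψ : ‖ψ₂‖ = ‖ψ₁‖)
    (hS : ∀ x : S₁.domain, ∃ y : S₂.domain,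
      ‖S₂ y‖ = ‖S₁ x‖ ∧ ‖(y : H)‖ = ‖(x : H)‖ ∧ ⟪ψ₂, (y : H)⟫_ℂ = ⟪ψ₁, (x : H)⟫_ℂ) :
    (negForm (negLogAdjointMul S₁) ψ₁ ≠ ⊤ → negForm (negLogAdjointMul S₂) ψ₂ ≠ ⊤) ∧
      (posForm (negLogAdjointMul S₂) ψ₂ ≠ ⊤ → posForm (negLogAdjointMul S₁) ψ₁ ≠ ⊤) ∧
      form (negLogAdjointMul S₁) ψ₁ ≤ form (negLogAdjointMul S₂) ψ₂ := by
  obtain ⟨C₁, hC₁, hp₁, hn₁⟩ := h₁.exists_form_correction ψ₁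
  obtain ⟨C₂, hC₂, hp₂, hn₂⟩ := h₂.exists_form_correction ψ₂
  have hpos : posForm (negLogAdjointMul S₁) ψ₁ + C₁ ≤ posForm (negLogAdjointMul S₂) ψ₂ + C₂ := by
    rw [hp₁, hp₂]
    refine setLIntegral_mono' measurableSet_Ioc fun t ht => ENNReal.ofReal_le_ofReal ?_
    exact integral_resolvent_mono h₁ h₂ hS ht.1
  have hneg : negForm (negLogAdjointMul S₂) ψ₂ + C₂ ≤ negForm (negLogAdjointMul S₁) ψ₁ + C₁ := by
    rw [hn₁, hn₂, hψ]
    refine setLIntegral_mono' measurableSet_Ioc fun t ht => ENNReal.ofReal_le_ofReal ?_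
    have := integral_resolvent_mono h₁ h₂ hS (inv_pos.mpr ht.1)
    gcongr
  refine ⟨fun h => ?_, fun h => ?_, ?_⟩
  · exact ne_top_of_le_ne_top (ENNReal.add_ne_top.mpr ⟨h, hC₁⟩) (le_self_add.trans hneg)
  · exact ne_top_of_le_ne_top (ENNReal.add_ne_top.mpr ⟨h, hC₂⟩) (le_self_add.trans hpos)
  -- Well-definedness is not required: subtraction in `EReal` is monotone even with `⊤ - ⊤ = ⊥`.
  · rw [form, form, ← ereal_sub_add_right_cancel (posForm _ ψ₁) _ hC₁,
      ← ereal_sub_add_right_cancel (posForm _ ψ₂) _ hC₂]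
    exact EReal.sub_le_sub (by exact_mod_cast hpos) (by exact_mod_cast hneg)

/-- A form version of `log (1 + x) ≤ x`. The trial vector `sψ` in the variational bound at `t = s⁻¹`
bounds the integrand over `(0, 1]` by `‖Sψ‖²`. -/
lemma negForm_ne_top (h : IsClosedInjective S) (ψ : S.domain) :
    negForm (negLogAdjointMul S) (ψ : H) ≠ ⊤ := by
  obtain ⟨C, -, -, hn⟩ := h.exists_form_correction (ψ : H)
  refine ne_top_of_le_ne_top (b := ∫⁻ _ in Set.Ioc (0 : ℝ) 1, ENNReal.ofReal (‖S ψ‖ ^ 2)) ?_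
    (le_self_add.trans (hn.le.trans (setLIntegral_mono' measurableSet_Ioc fun s hs =>
      ENNReal.ofReal_le_ofReal ?_)))
  · rw [setLIntegral_const]
    exact ENNReal.mul_ne_top ENNReal.ofReal_ne_top (by simp)
  · have h1 := h.le_integral_resolvent (ψ : H) (inv_pos.mpr hs.1) ((s : ℂ) • ψ)
    have h2 := inner_self_eq_norm_sq (𝕜 := ℂ) (ψ : H)
    rw [RCLike.re_to_complex] at h2
    rw [S.map_smulₛₗ, Submodule.coe_smul, inner_smul_right, Complex.re_ofReal_mul, h2, norm_smul,
      norm_smul, Complex.conj_ofReal, Complex.norm_real, Real.norm_of_nonneg hs.1.le] at h1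
    have hs0 : s ≠ 0 := hs.1.ne'
    have h3 := mul_le_mul_of_nonneg_left h1 (sq_nonneg s⁻¹)
    have h4 : s⁻¹ ^ 2 * (2 * (s * ‖(ψ : H)‖ ^ 2) - (s * ‖S ψ‖) ^ 2
        - s⁻¹ * (s * ‖(ψ : H)‖) ^ 2) = s⁻¹ * ‖(ψ : H)‖ ^ 2 - ‖S ψ‖ ^ 2 := by
      field_simp
      ring
    linarith

end IsClosedInjective

open Classical in
lemma spectralMeasureAt_conjBy {w : H →L[ℂ] H} (hw : w ∈ unitary (H →L[ℂ] H))
    (T : H →ₗ.[ℂ] H) (ψ : H) :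
    spectralMeasureAt (conjBy w T) ψ = spectralMeasureAt T ((star w : H →L[ℂ] H) ψ) := by
  have hws (x : H) : w ((star w : H →L[ℂ] H) x) = x := by
    rw [← mul_apply_eq_comp, Unitary.mul_star_self_of_mem hw, one_apply_eq_self]
  have hsw (x : H) : (star w : H →L[ℂ] H) (w x) = x := by
    rw [← mul_apply_eq_comp, Unitary.star_mul_self_of_mem hw, one_apply_eq_self]
  have hinner (x y : H) : ⟪(star w : H →L[ℂ] H) x, y⟫_ℂ = ⟪x, w y⟫_ℂ := by
    rw [ContinuousLinearMap.star_eq_adjoint, ContinuousLinearMap.adjoint_inner_left]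
  have h : ∀ μ, IsSpectralMeasureAt (conjBy w T) ψ μ
      ↔ IsSpectralMeasureAt T ((star w : H →L[ℂ] H) ψ) μ := by
    refine fun μ => ⟨fun hμ => ⟨hμ.finite, fun z hz => ?_⟩, fun hμ => ⟨hμ.finite, fun z hz => ?_⟩⟩
    · obtain ⟨φ, h1, h2⟩ := hμ.resolvent z hz
      refine ⟨⟨(star w : H →L[ℂ] H) φ, φ.2⟩, ?_, ?_⟩
      · rw [← h1, map_sub, map_smul]
        change _ = (star w : H →L[ℂ] H) (w (T _)) - _
        rw [hsw]
      · rw [hinner, hws, h2]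
    · obtain ⟨φ, h1, h2⟩ := hμ.resolvent z hz
      refine ⟨⟨w φ, ?_⟩, ?_, ?_⟩
      · change (star w : H →L[ℂ] H) (w φ) ∈ T.domain
        rw [hsw]
        exact φ.2
      · change w (T ⟨(star w : H →L[ℂ] H) (w φ), _⟩) - z • w φ = ψ
        simp only [hsw, Subtype.coe_eta]
        rw [← map_smul, ← map_sub, h1, hws]
      · rw [← hinner, h2]
  have h' : (IsSpectralMeasureAt (conjBy w T) ψ)
      = IsSpectralMeasureAt T ((star w : H →L[ℂ] H) ψ) := funext fun μ => propext (h μ)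
  -- Equal predicates lead to the same choice, so `T` is arbitrary: neither existence nor uniqueness
  -- of the spectral measure is needed.
  have hchoose : ∀ P Q : Measure ℝ → Prop, P = Q →
      (if h : ∃ μ, P μ then h.choose else 0) = if h : ∃ μ, Q μ then h.choose else 0 := by
    rintro P _ rfl
    rfl
  exact hchoose _ _ h'

end Forms

/-! ### Relative Tomita operators of standard vectors and their comparison. -/

section Tomita

variable {R : VonNeumannAlgebra H} {Φ Φ' : H}

/-- A separating vector is cyclic for the commutant. -/
lemma IsStandard.dense_commutant (h : IsStandard R Φ) :
    Dense {x : H | ∃ a ∈ R.commutant, x = a Φ} := by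
  let M : Submodule ℂ H :=
    { carrier := {x : H | ∃ a ∈ R.commutant, x = a Φ}
      zero_mem' := ⟨0, zero_mem _, rfl⟩
      add_mem' := by
        rintro _ _ ⟨a, ha, rfl⟩ ⟨b, hb, rfl⟩
        exact ⟨a + b, add_mem ha hb, rfl⟩
      smul_mem' := by
        rintro c _ ⟨a, ha, rfl⟩
        exact ⟨c • a, R.commutant.toStarSubalgebra.smul_mem ha c, rfl⟩ }
  let N := M.topologicalClosure
  have : CompleteSpace N := M.isClosed_topologicalClosure.completeSpace_coe
  -- The projection onto the closure of `R'Φ` lies in `R'' = R` and fixes `Φ`, as does `1`; since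
  -- `Φ` is separating they coincide.
  have hP : N.starProjection ∈ R := by
    rw [VonNeumannAlgebra.IsStarProjection.mem_iff isStarProjection_starProjection]
    intro y hy
    rw [Module.End.mem_invtSubmodule, Submodule.range_starProjection]
    intro x hx
    refine map_mem_closure (s := (M : Set H)) (t := (M : Set H)) y.continuous hx ?_
    rintro _ ⟨a, ha, rfl⟩
    exact ⟨y * a, mul_mem hy ha, rfl⟩
  have hΦ : Φ ∈ N := M.le_topologicalClosure ⟨1, one_mem _, rfl⟩
  have h1 : N.starProjection = 1 := by
    refine h.separating hP (one_mem R) ?_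
    exact Submodule.starProjection_eq_self_iff.mpr hΦ
  change Dense (M : Set H)
  rw [Submodule.dense_iff_topologicalClosure_eq_top, eq_top_iff]
  intro x _
  rw [← Submodule.starProjection_eq_self_iff (K := M.topologicalClosure)]
  exact congrArg (fun A : H →L[ℂ] H => A x) h1

/-- The Tomita operator of the commutant is contained in the adjoint of that of `R`. Closability
follows by density of `R'Φ`, injectivity by density of `R'Φ'`. -/
lemma inner_eq_of_mem_tomitaGraph {p : H × H} (hp : p ∈ tomitaGraph R Φ' Φ)
    {a : H →L[ℂ] H} (ha : a ∈ R.commutant) :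
    ⟪a Φ, p.2⟫_ℂ = ⟪p.1, (star a : H →L[ℂ] H) Φ'⟫_ℂ := by
  have hcl : IsClosed {p : H × H | ⟪a Φ, p.2⟫_ℂ = ⟪p.1, (star a : H →L[ℂ] H) Φ'⟫_ℂ} :=
    isClosed_eq (by fun_prop) (by fun_prop)
  refine closure_minimal ?_ hcl hp
  rintro _ ⟨b, hb, rfl⟩
  change ⟪a Φ, (star b : H →L[ℂ] H) Φ'⟫_ℂ = ⟪b Φ, (star a : H →L[ℂ] H) Φ'⟫_ℂ
  rw [ContinuousLinearMap.star_eq_adjoint, ContinuousLinearMap.star_eq_adjoint,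
    ContinuousLinearMap.adjoint_inner_right, ContinuousLinearMap.adjoint_inner_right,
    ← mul_apply_eq_comp, ← mul_apply_eq_comp, VonNeumannAlgebra.mem_commutant_iff.mp ha b hb]

lemma IsStandard.tomitaGraph_unique (h : IsStandard R Φ) (ψ η ξ : H)
    (hη : (ψ, η) ∈ tomitaGraph R Φ' Φ) (hξ : (ψ, ξ) ∈ tomitaGraph R Φ' Φ) : η = ξ := by
  rw [← sub_eq_zero]
  refine h.dense_commutant.eq_zero_of_inner_right ℂ ?_
  rintro _ ⟨a, ha, rfl⟩
  rw [inner_sub_right, inner_eq_of_mem_tomitaGraph hη ha, inner_eq_of_mem_tomitaGraph hξ ha,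
    sub_self]

lemma IsStandard.relTomita_mem (h : IsStandard R Φ) (x : (relTomita R Φ' Φ).domain) :
    ((x : H), relTomita R Φ' Φ x) ∈ tomitaGraph R Φ' Φ := by
  have h1 : (relTomita R Φ' Φ) x = x.2.choose := by
    change (relTomita R Φ' Φ).toFun x = _
    unfold relTomita
    simp only [dif_pos h.tomitaGraph_unique]
    rfl
  rw [h1]
  exact x.2.choose_spec

lemma IsStandard.exists_relTomita_eq (h : IsStandard R Φ) {p : H × H}
    (hp : p ∈ tomitaGraph R Φ' Φ) :
    ∃ x : (relTomita R Φ' Φ).domain, (x : H) = p.1 ∧ relTomita R Φ' Φ x = p.2 :=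
  ⟨⟨p.1, p.2, hp⟩, rfl, h.tomitaGraph_unique _ _ _ (h.relTomita_mem _) hp⟩

/-- The relative Tomita operator of two standard vectors. -/
theorem IsStandard.isClosedInjective (h : IsStandard R Φ) (h' : IsStandard R Φ') :
    IsClosedInjective (relTomita R Φ' Φ) where
  dense := h.cyclic.mono (by
    rintro _ ⟨a, ha, rfl⟩
    exact ⟨_, subset_closure ⟨a, ha, rfl⟩⟩)
  closed := by
    have h1 : {p : H × H | ∃ x : (relTomita R Φ' Φ).domain, p = ((x : H), relTomita R Φ' Φ x)}
        = tomitaGraph R Φ' Φ := by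
      ext p
      constructor
      · rintro ⟨x, rfl⟩
        exact h.relTomita_mem x
      · intro hp
        obtain ⟨x, hx, hx'⟩ := h.exists_relTomita_eq hp
        exact ⟨x, by rw [hx, hx']⟩
    rw [h1]
    exact isClosed_closure
  injective := by
    intro x hx
    have h1 := h.relTomita_mem x
    refine Subtype.ext (h'.dense_commutant.eq_zero_of_inner_left ℂ ?_)
    rintro _ ⟨a, ha, rfl⟩
    have h2 := inner_eq_of_mem_tomitaGraph h1 (star_mem ha)
    rw [hx, inner_zero_right, star_star] at h2
    exact h2.symm

lemma IsStandard.negForm_relModularHamiltonian_ne_top (h : IsStandard R Φ)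
    (h' : IsStandard R Φ') {a : H →L[ℂ] H} (ha : a ∈ R) :
    negForm (relModularHamiltonian R Φ' Φ) (a Φ) ≠ ⊤ :=
  (h.isClosedInjective h').negForm_ne_top ⟨a Φ, _, subset_closure ⟨a, ha, rfl⟩⟩

lemma norm_apply_of_mem_unitary {w : H →L[ℂ] H} (hw : w ∈ unitary (H →L[ℂ] H)) (x : H) :
    ‖w x‖ = ‖x‖ :=
  ContinuousLinearMap.norm_map_of_mem_unitary hw x

lemma inner_apply_of_mem_unitary {w : H →L[ℂ] H} (hw : w ∈ unitary (H →L[ℂ] H)) (x y : H) :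
    ⟪w x, w y⟫_ℂ = ⟪x, y⟫_ℂ :=
  ContinuousLinearMap.inner_map_map_of_mem_unitary hw x y

/-- Comparison of relative modular Hamiltonians when one Tomita operator extends the other up to
unitaries. -/
theorem relModularHamiltonian_mono {R₁ R₂ : VonNeumannAlgebra H} {Φ₁ Φ₁' Φ₂ Φ₂' : H}
    (h₁ : IsStandard R₁ Φ₁) (h₁' : IsStandard R₁ Φ₁') (h₂ : IsStandard R₂ Φ₂)
    (h₂' : IsStandard R₂ Φ₂') {V W : H →L[ℂ] H} (hV : V ∈ unitary (H →L[ℂ] H))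
    (hW : W ∈ unitary (H →L[ℂ] H))
    (hVW : ∀ a ∈ R₁, ∃ b ∈ R₂, b Φ₂ = V (a Φ₁) ∧
      (star b : H →L[ℂ] H) Φ₂' = W ((star a : H →L[ℂ] H) Φ₁')) (ψ : H) :
    (negForm (relModularHamiltonian R₁ Φ₁' Φ₁) ψ ≠ ⊤ →
        negForm (relModularHamiltonian R₂ Φ₂' Φ₂) (V ψ) ≠ ⊤) ∧
      (posForm (relModularHamiltonian R₂ Φ₂' Φ₂) (V ψ) ≠ ⊤ →
        posForm (relModularHamiltonian R₁ Φ₁' Φ₁) ψ ≠ ⊤) ∧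
      form (relModularHamiltonian R₁ Φ₁' Φ₁) ψ
        ≤ form (relModularHamiltonian R₂ Φ₂' Φ₂) (V ψ) := by
  refine IsClosedInjective.negLog_mono (h₁.isClosedInjective h₁') (h₂.isClosedInjective h₂')
    (norm_apply_of_mem_unitary hV ψ) fun x => ?_
  -- `V × W` is continuous, so the inclusion of the algebraic graphs passes to their closures.
  have hmem : (V x, W (relTomita R₁ Φ₁' Φ₁ x)) ∈ tomitaGraph R₂ Φ₂' Φ₂ := by
    refine map_mem_closure (f := fun p : H × H => (V p.1, W p.2)) (by fun_prop)
      (h₁.relTomita_mem x) ?_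
    rintro _ ⟨a, ha, rfl⟩
    obtain ⟨b, hb, h1, h2⟩ := hVW a ha
    exact ⟨b, hb, by rw [h1, h2]⟩
  obtain ⟨y, hy, hy'⟩ := h₂.exists_relTomita_eq hmem
  refine ⟨y, ?_, ?_, ?_⟩
  · rw [hy', norm_apply_of_mem_unitary hW]
  · rw [hy, norm_apply_of_mem_unitary hV]
  · rw [hy, inner_apply_of_mem_unitary hV]

lemma star_apply_apply_of_mem_unitary {w : H →L[ℂ] H} (hw : w ∈ unitary (H →L[ℂ] H)) (x : H) :
    (star w : H →L[ℂ] H) (w x) = x := by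
  rw [← mul_apply_eq_comp, Unitary.star_mul_self_of_mem hw, one_apply_eq_self]

lemma apply_star_apply_of_mem_unitary {w : H →L[ℂ] H} (hw : w ∈ unitary (H →L[ℂ] H)) (x : H) :
    w ((star w : H →L[ℂ] H) x) = x := by
  rw [← mul_apply_eq_comp, Unitary.mul_star_self_of_mem hw, one_apply_eq_self]

lemma IsStandard.apply_unitary (h : IsStandard R Φ) {w : H →L[ℂ] H}
    (hw : w ∈ unitary (H →L[ℂ] H)) (hwR : w ∈ R) : IsStandard R (w Φ) where
  separating := by
    intro a ha b hb hab
    have h1 : a * w = b * w := h.separating (mul_mem ha hwR) (mul_mem hb hwR) hab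
    calc a = a * w * star w := by rw [mul_assoc, Unitary.mul_star_self_of_mem hw, mul_one]
      _ = b * w * star w := by rw [h1]
      _ = b := by rw [mul_assoc, Unitary.mul_star_self_of_mem hw, mul_one]
  cyclic := h.cyclic.mono (by
    rintro _ ⟨a, ha, rfl⟩
    exact ⟨a * star w, mul_mem ha (star_mem hwR),
      congrArg a (star_apply_apply_of_mem_unitary hw Φ)⟩)

lemma IsStandard.of_apply_unitary {w : H →L[ℂ] H} (h : IsStandard R (w Φ))
    (hw : w ∈ unitary (H →L[ℂ] H)) (hwR : w ∈ R) : IsStandard R Φ := by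
  have h1 := h.apply_unitary (Unitary.star_mem hw) (star_mem hwR)
  rwa [star_apply_apply_of_mem_unitary hw] at h1

lemma apply_comm_of_mem_commutant {a w : H →L[ℂ] H} (ha : a ∈ R) (hw : w ∈ R.commutant) (x : H) :
    a (w x) = w (a x) :=
  congrArg (fun A : H →L[ℂ] H => A x) (VonNeumannAlgebra.mem_commutant_iff.mp hw a ha)

lemma IsStandard.apply_unitary_commutant (h : IsStandard R Φ) {w : H →L[ℂ] H}
    (hw : w ∈ unitary (H →L[ℂ] H)) (hwR : w ∈ R.commutant) : IsStandard R (w Φ) where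
  separating := by
    intro a ha b hb hab
    refine h.separating ha hb ?_
    simp only [apply_comm_of_mem_commutant ha hwR, apply_comm_of_mem_commutant hb hwR] at hab
    have h1 := congrArg (star w : H →L[ℂ] H) hab
    rwa [star_apply_apply_of_mem_unitary hw, star_apply_apply_of_mem_unitary hw] at h1
  cyclic := by
    have hsurj : Function.Surjective w := fun x => ⟨_, apply_star_apply_of_mem_unitary hw x⟩
    refine (hsurj.denseRange.dense_image w.continuous h.cyclic).mono ?_
    rintro _ ⟨_, ⟨a, ha, rfl⟩, rfl⟩
    exact ⟨a, ha, apply_comm_of_mem_commutant ha hwR Φ⟩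

lemma IsStandard.of_apply_unitary_commutant {w : H →L[ℂ] H} (h : IsStandard R (w Φ))
    (hw : w ∈ unitary (H →L[ℂ] H)) (hwR : w ∈ R.commutant) : IsStandard R Φ := by
  have h1 := h.apply_unitary_commutant (Unitary.star_mem hw) (star_mem hwR)
  rwa [star_apply_apply_of_mem_unitary hw] at h1

end Tomita

/-! ### Forms of unitarily conjugated operators. -/

section Conj

variable {w : H →L[ℂ] H} (hw : w ∈ unitary (H →L[ℂ] H)) (T : H →ₗ.[ℂ] H) (ψ : H)

include hw

lemma posForm_conjBy : posForm (conjBy w T) ψ = posForm T ((star w : H →L[ℂ] H) ψ) := by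
  rw [posForm, posForm, spectralMeasureAt_conjBy hw]

lemma negForm_conjBy : negForm (conjBy w T) ψ = negForm T ((star w : H →L[ℂ] H) ψ) := by
  rw [negForm, negForm, spectralMeasureAt_conjBy hw]

lemma form_conjBy : form (conjBy w T) ψ = form T ((star w : H →L[ℂ] H) ψ) := by
  rw [form, form, posForm_conjBy hw, negForm_conjBy hw]

end Conj

lemma posForm_ne_top_of_form_ne_top {T : H →ₗ.[ℂ] H} {ψ : H} (hn : negForm T ψ ≠ ⊤)
    (h : form T ψ ≠ ⊤) : posForm T ψ ≠ ⊤ := by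
  intro hp
  apply h
  rw [form, hp]
  lift negForm T ψ to NNReal using hn with n
  exact EReal.top_sub_coe (n : ℝ)

end RelMod

/-! ### The comparison theorem. -/

theorem theorem2 {H : Type*} [NormedAddCommGroup H] [InnerProductSpace ℂ H] [CompleteSpace H]
    (R₁ R₂ : VonNeumannAlgebra H) (hR : R₁ ≤ R₂) (Ω : H)
    (u v u' v' : H →L[ℂ] H)
    (hu : u ∈ unitary (H →L[ℂ] H)) (hv : v ∈ unitary (H →L[ℂ] H))
    (hu' : u' ∈ unitary (H →L[ℂ] H)) (hv' : v' ∈ unitary (H →L[ℂ] H))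
    (huR : u ∈ R₂) (hvR : v ∈ R₂) (hu'R : u' ∈ R₁.commutant) (hv'R : v' ∈ R₁.commutant) :
    (RelMod.IsStandard R₁ (u Ω) → RelMod.IsStandard R₂ (u Ω) →
      RelMod.IsStandard R₁ (v Ω) → RelMod.IsStandard R₂ (v Ω) →
        RelMod.FormLE (RelMod.relModularHamiltonian R₁ (u' (u Ω)) (v' (v Ω)))
          (RelMod.conjBy (v' * u) (RelMod.modularHamiltonian R₂ Ω)) ∧
        RelMod.HasForm (RelMod.relModularHamiltonian R₁ (u' (u Ω)) (v' (v Ω))) (v' (v Ω)) ∧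
        RelMod.HasForm (RelMod.modularHamiltonian R₂ Ω) (star u (v Ω)) ∧
        RelMod.relativeEntropy R₁ (v' (v Ω)) (u' (u Ω)) ≤
          RelMod.form (RelMod.modularHamiltonian R₂ Ω) (star u (v Ω))) ∧
    (RelMod.IsStandard R₁ (u' Ω) → RelMod.IsStandard R₂ (u' Ω) →
      RelMod.IsStandard R₁ (v' Ω) → RelMod.IsStandard R₂ (v' Ω) →
        RelMod.FormLE (RelMod.conjBy (u * v') (RelMod.modularHamiltonian R₁ Ω))
          (RelMod.relModularHamiltonian R₂ (u (u' Ω)) (v (v' Ω))) ∧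
        RelMod.HasForm (RelMod.relModularHamiltonian R₂ (u (u' Ω)) (v (v' Ω))) (v (v' Ω)) ∧
        (RelMod.relativeEntropy R₂ (v (v' Ω)) (u (u' Ω)) ≠ ⊤ →
          RelMod.HasForm (RelMod.modularHamiltonian R₁ Ω) (star v' (star u (v (v' Ω))))) ∧
        RelMod.form (RelMod.modularHamiltonian R₁ Ω) (star v' (star u (v (v' Ω)))) ≤
          RelMod.relativeEntropy R₂ (v (v' Ω)) (u (u' Ω))) := by
  open RelMod in
  refine ⟨fun huΩ₁ huΩ₂ hvΩ₁ _ => ?_, fun huΩ₁ huΩ₂ _ hvΩ₂ => ?_⟩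
  · have hΩ : IsStandard R₂ Ω := huΩ₂.of_apply_unitary hu huR
    have hv'v := hvΩ₁.apply_unitary_commutant hv' hv'R
    have hu'u := huΩ₁.apply_unitary_commutant hu' hu'R
    have hw : v' * u ∈ unitary (H →L[ℂ] H) := mul_mem hv' hu
    have key := relModularHamiltonian_mono hv'v hu'u hΩ hΩ (Unitary.star_mem hw)
      (W := star v * star u') (mul_mem (Unitary.star_mem hv) (Unitary.star_mem hu'))
      (fun a ha => by
        refine ⟨star u * a * v, mul_mem (mul_mem (star_mem huR) (hR ha)) hvR, ?_, ?_⟩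
        · simp only [star_mul, mul_apply_eq_comp]
          rw [apply_comm_of_mem_commutant ha hv'R, star_apply_apply_of_mem_unitary hv']
        · simp only [star_mul, star_star, mul_apply_eq_comp]
          rw [apply_comm_of_mem_commutant (star_mem ha) hu'R,
            star_apply_apply_of_mem_unitary hu'])
    have hvec : (star (v' * u) : H →L[ℂ] H) (v' (v Ω)) = (star u : H →L[ℂ] H) (v Ω) := by
      rw [star_mul, mul_apply_eq_comp, star_apply_apply_of_mem_unitary hv']
    refine ⟨fun ψ => ?_, Or.inr ?_, Or.inr ?_, ?_⟩
    · rw [negForm_conjBy hw, posForm_conjBy hw, form_conjBy hw]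
      exact ⟨(key ψ).1, (key ψ).2.1, fun _ _ => (key ψ).2.2⟩
    · exact hv'v.negForm_relModularHamiltonian_ne_top hu'u (one_mem R₁)
    -- `u*v ∈ R₂`, so `u*vΩ` lies in the domain of the Tomita operator of `R₂`.
    · exact hΩ.negForm_relModularHamiltonian_ne_top hΩ (mul_mem (star_mem huR) hvR)
    · have h := (key (v' (v Ω))).2.2
      rw [hvec] at h
      exact h
  · have hΩ : IsStandard R₁ Ω := huΩ₁.of_apply_unitary_commutant hu' hu'R
    have hvv' := hvΩ₂.apply_unitary hv hvR
    have huu' := huΩ₂.apply_unitary hu huR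
    have hw : u * v' ∈ unitary (H →L[ℂ] H) := mul_mem hu hv'
    have key (ψ : H) := relModularHamiltonian_mono hΩ hΩ hvv' huu' hw (W := v * u')
      (mul_mem hv hu')
      (fun a ha => by
        refine ⟨u * a * star v, mul_mem (mul_mem huR (hR ha)) (star_mem hvR), ?_, ?_⟩
        · simp only [mul_apply_eq_comp]
          rw [star_apply_apply_of_mem_unitary hv, apply_comm_of_mem_commutant ha hv'R]
        · simp only [star_mul, star_star, mul_apply_eq_comp]
          rw [star_apply_apply_of_mem_unitary hu,
            apply_comm_of_mem_commutant (star_mem ha) hu'R])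
      ((star (u * v') : H →L[ℂ] H) ψ)
    simp only [apply_star_apply_of_mem_unitary hw] at key
    have hneg : negForm (relModularHamiltonian R₂ (u (u' Ω)) (v (v' Ω))) (v (v' Ω)) ≠ ⊤ :=
      hvv'.negForm_relModularHamiltonian_ne_top huu' (one_mem R₂)
    have hvec : (star (u * v') : H →L[ℂ] H) (v (v' Ω))
        = (star v' : H →L[ℂ] H) ((star u : H →L[ℂ] H) (v (v' Ω))) := by
      rw [star_mul, mul_apply_eq_comp]
    have h := key (v (v' Ω))
    rw [hvec] at h
    -- Here `v'*u*vv'Ω` need not lie in `R₁Ω`; finite entropy bounds the positive part instead. If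
    -- the form on the left is not well defined, its value is `⊥` and the last inequality is
    -- trivial.
    refine ⟨fun ψ => ?_, Or.inr hneg, fun hent => Or.inl ?_, h.2.2⟩
    · rw [negForm_conjBy hw, posForm_conjBy hw, form_conjBy hw]
      exact ⟨(key ψ).1, (key ψ).2.1, fun _ _ => (key ψ).2.2⟩
    · exact h.2.1 (posForm_ne_top_of_form_ne_top hneg hent)
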